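/- **Setting.** For $d\ge 1$ and a probability measure $G$ (a prior) on $\mathbb{R}_+^d$ let $$f_G(\boldsymbol y)=\int \prod_{j=1}^d e^{-\theta_j}\frac{\theta_j^{y_j}}{y_j!}\,dG(\boldsymbol\theta),\qquad \boldsymbol y\in\mathbb{Z}_+^d,$$ be the Poisson mixture, and let $\hat{\boldsymbol\theta}_G(\boldsymbol y)=(\hat\theta_{G,1}(\boldsymbol y),\dots,\hat\theta_{G,d}(\boldsymbol y))$, where $$\hat\theta_{G,j}(\boldsymbol y)=\frac{1}{f_G(\boldsymbol y)}\int \theta_j\prod_{k=1}^d e^{-\theta_k}\frac{\theta_k^{y_k}}{y_k!}\,dG(\boldsymbol\theta),$$ be the Bayes estimator (posterior mean, with $0/0=0$). Let $\boldsymbol Y_1,\dots,\boldsymbol Y_n$ be i.i.d. from $f_G$, and let $p_n=\frac1n\sum_{i=1}^n\delta_{\boldsymbol Y_i}$. For an estimate $\hat G=\hat G(\boldsymbol Y_1,\dots,\boldsymbol Y_n)$ of the prior, the regret is $$\mathsf{Regret}(\hat G;G)=\mathbb{E}_G\Big[\sum_{\boldsymbol y\in\mathbb{Z}_+^d}\|\hat{\boldsymbol\theta}_{\hat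 G}(\boldsymbol y)-\hat{\boldsymbol\theta}_G(\boldsymbol y)\|^2 f_G(\boldsymbol y)\Big].$$ Let $\mathsf{dist}(q_1\|q_2)\in[0,\infty]$ be defined for pmfs $q_1,q_2$ on $\mathbb{Z}_+^d$ and satisfy: 1. $\mathsf{dist}(q_1\|q_2)=t(q_1)+\sum_{\boldsymbol y}\ell(q_1(\boldsymbol y),q_2(\boldsymbol y))$ for all $q_1,q_2$, where $t$ is real-valued, $\ell$ takes values in the extended reals, $b\mapsto\ell(a,b)$ is strictly decreasing and strictly convex on $[0,\infty)$ for every $a>0$, and $\ell(0,b)=0$ for $b\ge0$; 2. $a\,H^2(q_1,q_2)\le\mathsf{dist}(q_1\|q_2)\le b\,\chi^2(q_1\|q_2)$ for all $q_1,q_2$, with constants $a,b>0$, where $H^2(q_1,q_2)=\sum_{\boldsymbol y}(\sqrt{q_1(\boldsymbol y)}-\sqrt{q_2(\boldsymbol y)})^2$ and $\chi^2(q_1\|q_2)=\sum_{\boldsymbol y}(q_1(\boldsymbol y)-q_2(\boldsymbol y))^2/q_2(\boldsymbol y)$. A minimum-distance estimator over a class $\mathcal G$ of priors is any $\hat G\in\operatorname{argmin}_{Q\in\mathcal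 G}\mathsf{dist}(p_n\|f_Q)$. **Theorem.** For all $a,b>0$ there exist constants $c_1,c_2>0$, depending only on $a$ and $b$, such that for all $d$, all $n\ge d$ and all $\mathsf{dist}$ as above: 1. If $n\ge3$, $h\ge0$, $G$ is supported on $[0,h]^d$, and $\hat G$ is a minimum-distance estimator over the priors supported on $[0,h]^d$, then $$\mathsf{Regret}(\hat G;G)\le\frac{d\,(c_1\max\{1,h\})^{d+2}}{n}\Big(\frac{\log n}{\log\log n}\Big)^{d+1}.$$ 2. If $n\ge2$, $s>0$, every one-dimensional marginal $G_j$ of $G$ is $s$-subexponential, i.e. $G_j([t,\infty))\le2e^{-t/s}$ for all $t>0$, and $\hat G$ is a minimum-distance estimator over all priors on $\mathbb{R}_+^d$, then $$\mathsf{Regret}(\hat G;G)\le\frac{d\,(c_2\max\{1,s\})^{d+2}}{n}(\log n)^{d+2}.$$ -/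

import Mathlib

open MeasureTheory
open scoped NNReal ENNReal

noncomputable section

/-- Probability measures on `ℝ₊^d`, the possible priors. -/
abbrev Prior (d : ℕ) := ProbabilityMeasure (Fin d → ℝ≥0)

/-- Probability mass at `y ∈ ℤ₊^d` of independent Poisson coordinates with means `θ j`. -/
def poissonLik {d : ℕ} (θ : Fin d → ℝ≥0) (y : Fin d → ℕ) : ℝ≥0∞ :=
  ∏ j, ENNReal.ofReal (Real.exp (-(θ j : ℝ)) * (θ j : ℝ) ^ y j / (Nat.factorial (y j) : ℝ))

theorem poissonLik_eq_pi {d : ℕ} (θ : Fin d → ℝ≥0) (y : Fin d → ℕ) :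
    poissonLik θ y = Measure.pi (fun j => ProbabilityTheory.poissonMeasure (θ j)) {y} := by
  rw [Measure.pi_singleton, poissonLik]
  refine Finset.prod_congr rfl fun j _ => ?_
  rw [ProbabilityTheory.poissonMeasure, Measure.sum_smul_dirac_singleton]

theorem tsum_poissonLik {d : ℕ} (θ : Fin d → ℝ≥0) : ∑' y, poissonLik θ y = 1 := by
  have h := (Measure.pi (fun j => ProbabilityTheory.poissonMeasure (θ j))).tsum_indicator_apply_singleton
    Set.univ MeasurableSet.univ
  simpa only [Set.indicator_univ, ← poissonLik_eq_pi, measure_univ] using h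

theorem measurable_poissonLik {d : ℕ} (y : Fin d → ℕ) :
    Measurable (fun θ : Fin d → ℝ≥0 => poissonLik θ y) := by
  unfold poissonLik
  fun_prop

/-- The Poisson mixture `f_G`, as a probability mass function on `ℤ₊^d`. -/
def mixture {d : ℕ} (G : Prior d) : PMF (Fin d → ℕ) :=
  ⟨fun y => ∫⁻ θ, poissonLik θ y ∂(G : Measure (Fin d → ℝ≥0)), by
    have h : ∑' y, ∫⁻ θ, poissonLik θ y ∂(G : Measure (Fin d → ℝ≥0)) = 1 := by
      rw [← lintegral_tsum fun y => (measurable_poissonLik y).aemeasurable]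
      simp [tsum_poissonLik]
    exact h ▸ ENNReal.summable.hasSum⟩

/-- Coordinate `j` of the Bayes estimator under the prior `G` at the observation `y`, i.e. the
posterior mean of `θ j` (with `0 / 0 = 0` if `f_G(y) = 0`). -/
def bayesEst {d : ℕ} (G : Prior d) (y : Fin d → ℕ) (j : Fin d) : ℝ :=
  ((∫⁻ θ, (θ j : ℝ≥0∞) * poissonLik θ y ∂(G : Measure (Fin d → ℝ≥0))) / mixture G y).toReal

/-- The empirical distribution of the sample `Y 0, …, Y (n - 1)`. -/
def empirical {d n : ℕ} [NeZero n] (Y : Fin n → Fin d → ℕ) : PMF (Fin d → ℕ) :=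
  (PMF.uniformOfFintype (Fin n)).map Y

/-- The regret of the estimate `Ghat` of the prior (a function of the training sample), when the
training sample is i.i.d. from `f_G` and the test point is an independent draw from `f_G`. -/
def regret {d n : ℕ} (Ghat : (Fin n → Fin d → ℕ) → Prior d) (G : Prior d) : ℝ≥0∞ :=
  ∫⁻ Y, ∑' y, ENNReal.ofReal (∑ j, (bayesEst (Ghat Y) y j - bayesEst G y j) ^ 2) * mixture G y
    ∂(Measure.pi fun _ : Fin n => (mixture G).toMeasure)

/-- Squared Hellinger distance. -/
def sqHellinger {α : Type*} (p q : PMF α) : ℝ≥0∞ :=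
  ∑' y, ENNReal.ofReal ((√(p y).toReal - √(q y).toReal) ^ 2)

/-- The `χ²`-divergence; a term with `q y = 0` is `0` if `p y = 0` and `∞` otherwise. -/
def chiSq {α : Type*} (p q : PMF α) : ℝ≥0∞ :=
  ∑' y, ENNReal.ofReal (((p y).toReal - (q y).toReal) ^ 2) / q y

/-- `dist(p ‖ q) = t(p) + ∑ y, ℓ(p y, q y)` with `ℓ(a, ·)` strictly decreasing and strictly convex
on `[0, ∞)` for `a > 0`, and `ℓ(0, ·) = 0`. Extended values are allowed, since for the
Kullback-Leibler and `χ²` divergences `ℓ(a, 0) = ∞` for `a > 0`. (As `ℓ(a, ·)` is strictly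
decreasing, it never takes the value `-∞`, and it can be `∞` only at `0`.) -/
def IsDecomposable {α : Type*} (dist : PMF α → PMF α → ℝ≥0∞) : Prop :=
  ∃ (t : PMF α → ℝ) (l : ℝ → ℝ → EReal),
    (∀ p q : PMF α, ∃ S : EReal,
      HasSum (fun y => l (p y).toReal (q y).toReal) S ∧ (dist p q : EReal) = (t p : EReal) + S) ∧
    (∀ a : ℝ, 0 < a → StrictAntiOn (l a) (Set.Ici 0)) ∧
    (∀ a : ℝ, 0 < a → ∀ x ∈ Set.Ici (0 : ℝ), ∀ z ∈ Set.Ici (0 : ℝ), x ≠ z →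
      ∀ r : ℝ, 0 < r → r < 1 →
        l a ((1 - r) * x + r * z) < ((1 - r : ℝ) : EReal) * l a x + (r : EReal) * l a z) ∧
    (∀ b : ℝ, 0 ≤ b → l 0 b = 0)

/-- `a H² ≤ dist ≤ b χ²`. -/
def IsSandwiched {α : Type*} (a b : ℝ) (dist : PMF α → PMF α → ℝ≥0∞) : Prop :=
  ∀ p q : PMF α, ENNReal.ofReal a * sqHellinger p q ≤ dist p q ∧
    dist p q ≤ ENNReal.ofReal b * chiSq p q

/-- `Q` minimizes `dist(p ‖ f_Q)` over the class `𝒢` of priors. -/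
def IsMinDist {d : ℕ} (dist : PMF (Fin d → ℕ) → PMF (Fin d → ℕ) → ℝ≥0∞) (𝒢 : Set (Prior d))
    (p : PMF (Fin d → ℕ)) (Q : Prior d) : Prop :=
  Q ∈ 𝒢 ∧ ∀ Q' ∈ 𝒢, dist p (mixture Q) ≤ dist p (mixture Q')

/-- The priors supported on `[0, h]^d`. -/
def boxPriors (d : ℕ) (h : ℝ) : Set (Prior d) :=
  {G | (G : Measure (Fin d → ℝ≥0)) {θ | ∀ j, (θ j : ℝ) ≤ h} = 1}

/-- The `s`-subexponential distributions on `ℝ₊`. -/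
def SubE (s : ℝ) : Set (Measure ℝ≥0) :=
  {μ | ∀ t : ℝ≥0, 0 < t → μ (Set.Ici t) ≤ ENNReal.ofReal (2 * Real.exp (-(t : ℝ) / s))}

/-- The priors on `ℝ₊^d` all of whose one-dimensional marginals are `s`-subexponential. -/
def subEPriors (d : ℕ) (s : ℝ) : Set (Prior d) :=
  {G | ∀ j, (G : Measure (Fin d → ℝ≥0)).map (fun θ => θ j) ∈ SubE s}

end

/-!
The argument is a comparison of the estimated and the true mixture in Hellinger distance, transferred
to posterior means by Robbins' formula `E[θ j | y] = (y j + 1) f(y + e j) / f(y)`.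

*From Hellinger distance to regret.* If two mixing measures are supported on `θ j ≤ h`, the
difference of their posterior means at `y`, squared and weighted by the mixture, is at most
`16 h²` times the squared Hellinger increment at `y` plus `16 h (y j + 1)` times the one at
`y + e j` (`mixLik_mul_sq_postMean_sub_le`). Below a level `K` the factor `y j + 1` is at most `K`;
beyond it, the posterior means differ by at most `h` and only the tail of the mixture matters
(`tsum_sq_postMean_sub_le`). A prior of unbounded support is split into its restriction to a box and
a remainder `ρ`, whose influence on the posterior mean is governed by the mass and the second moment
of `ρ`, by Jensen's inequality (`tsum_sq_postMean_sub_postMean_add_le`).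

*Bounding the Hellinger distance.* As `dist` lies between multiples of `H²` and `χ²` and the estimate
minimizes it, both the true and the estimated mixture are within `(b / a) χ²(p_n ‖ f_G)` of the
empirical distribution in `H²` (`hellSq_mixture_le_chiSq`). On the event that the whole sample lies
in `[0, K)^d`, each of the `K ^ d` cells contributes a binomial variance over its mean, at most
`1 / n`, and the other cells contribute their mass (`lintegral_indicator_chiSq_empirical_le`). The
complementary event has polynomially small probability for `K` of order `h log n / log log n`
(box) or `s log n` (subexponential), and the bound `h K * K ^ d / n`, with `h = K` in the second
case, is the rate (`regret_le_ofReal`).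

*Unconstrained estimates.* Without a box constraint the estimate is still supported below the
coordinatewise maximum of the sample (`ae_le_sampleMax_of_isMinDist`): Poisson likelihoods of
observations `y ≤ m` increase when a mean exceeding `m` is lowered to `m`, and `dist` is strictly
decreasing in the model probabilities of the observed points. On the rare event that the sample
leaves the box, the maximum is controlled by its fourth moment.
-/

/-! ### Poisson likelihoods and posterior means of general mixing measures -/

/-- The Poisson recursion in coordinate `j`, from which Robbins' formula follows. -/
theorem poissonLik_add_single {d : ℕ} (θ : Fin d → ℝ≥0) (y : Fin d → ℕ) (j : Fin d) :
    ((y j : ℝ≥0∞) + 1) * poissonLik θ (y + Pi.single j 1) = θ j * poissonLik θ y := by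
  unfold poissonLik
  rw [← Finset.mul_prod_erase Finset.univ _ (Finset.mem_univ j),
    ← Finset.mul_prod_erase Finset.univ (fun k => ENNReal.ofReal
      (Real.exp (-(θ k : ℝ)) * (θ k : ℝ) ^ y k / (Nat.factorial (y k) : ℝ))) (Finset.mem_univ j),
    ← mul_assoc, ← mul_assoc]
  congr 1
  · have h1 : ((y j : ℝ≥0∞) + 1) = ENNReal.ofReal ((y j : ℝ) + 1) := by
      rw [ENNReal.ofReal_add (by positivity) (by norm_num)]; simp
    rw [h1, ← ENNReal.ofReal_coe_nnreal, ← ENNReal.ofReal_mul (by positivity),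
      ← ENNReal.ofReal_mul (by positivity)]
    congr 1
    simp only [Pi.add_apply, Pi.single_eq_same, Nat.factorial_succ, pow_succ]
    push_cast
    field_simp
  · refine Finset.prod_congr rfl fun k hk => ?_
    simp [Pi.single_eq_of_ne (Finset.ne_of_mem_erase hk)]

/-- Exponential tilting: a factor `z ^ y j` turns a Poisson law with mean `θ j` into a multiple of
the Poisson law with mean `z * θ j`. -/
theorem pow_mul_poissonLik {d : ℕ} (θ : Fin d → ℝ≥0) (y : Fin d → ℕ) (j : Fin d) (z : ℝ≥0) :
    (z : ℝ≥0∞) ^ y j * poissonLik θ y =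
      ENNReal.ofReal (Real.exp ((θ j : ℝ) * (z - 1))) *
        poissonLik (Function.update θ j (z * θ j)) y := by
  unfold poissonLik
  rw [← Finset.mul_prod_erase Finset.univ _ (Finset.mem_univ j),
    ← Finset.mul_prod_erase Finset.univ (fun k => ENNReal.ofReal
      (Real.exp (-(Function.update θ j (z * θ j) k : ℝ)) *
        (Function.update θ j (z * θ j) k : ℝ) ^ y k / (Nat.factorial (y k) : ℝ)))
      (Finset.mem_univ j),
    ← mul_assoc, ← mul_assoc]
  congr 1
  · rw [← ENNReal.ofReal_coe_nnreal, ← ENNReal.ofReal_pow (by positivity),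
      ← ENNReal.ofReal_mul (by positivity), ← ENNReal.ofReal_mul (by positivity)]
    congr 1
    have h1 : Real.exp ((θ j : ℝ) * (z - 1)) * Real.exp (-(z * θ j : ℝ)) =
        Real.exp (-(θ j : ℝ)) := by
      rw [← Real.exp_add]; congr 1; ring
    simp only [Function.update_self, NNReal.coe_mul, mul_pow]
    rw [← h1]
    ring
  · refine Finset.prod_congr rfl fun k hk => ?_
    simp [Function.update_of_ne (Finset.ne_of_mem_erase hk)]

theorem tsum_pow_mul_poissonLik {d : ℕ} (θ : Fin d → ℝ≥0) (j : Fin d) (z : ℝ≥0) :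
    ∑' y, (z : ℝ≥0∞) ^ y j * poissonLik θ y =
      ENNReal.ofReal (Real.exp ((θ j : ℝ) * (z - 1))) := by
  simp_rw [pow_mul_poissonLik, ENNReal.tsum_mul_left, tsum_poissonLik, mul_one]

noncomputable section

/-- The Poisson mixture with an arbitrary mixing measure `μ`, for which `mixture` asks a
probability measure. -/
def mixLik {d : ℕ} (μ : Measure (Fin d → ℝ≥0)) (y : Fin d → ℕ) : ℝ≥0∞ :=
  ∫⁻ θ, poissonLik θ y ∂μ

/-- Coordinate `j` of the posterior mean under the mixing measure `μ`, in Robbins' form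
`(y j + 1) f(y + e j) / f(y)`. -/
def postMean {d : ℕ} (μ : Measure (Fin d → ℝ≥0)) (y : Fin d → ℕ) (j : Fin d) : ℝ :=
  ((y j : ℝ) + 1) * (mixLik μ (y + Pi.single j 1)).toReal / (mixLik μ y).toReal

end

theorem mixture_apply {d : ℕ} (G : Prior d) (y : Fin d → ℕ) :
    mixture G y = mixLik (G : Measure (Fin d → ℝ≥0)) y := rfl

theorem tsum_mixLik {d : ℕ} (μ : Measure (Fin d → ℝ≥0)) : ∑' y, mixLik μ y = μ Set.univ := by
  unfold mixLik
  rw [← lintegral_tsum fun y => (measurable_poissonLik y).aemeasurable]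
  simp [tsum_poissonLik]

theorem tsum_pow_mul_mixLik {d : ℕ} (μ : Measure (Fin d → ℝ≥0)) (j : Fin d) (z : ℝ≥0) :
    ∑' y, (z : ℝ≥0∞) ^ y j * mixLik μ y =
      ∫⁻ θ, ENNReal.ofReal (Real.exp ((θ j : ℝ) * (z - 1))) ∂μ := by
  unfold mixLik
  simp_rw [← lintegral_const_mul _ (measurable_poissonLik _)]
  rw [← lintegral_tsum fun y => ((measurable_poissonLik y).const_mul _).aemeasurable]
  simp_rw [tsum_pow_mul_poissonLik]

theorem mixLik_ne_top {d : ℕ} (μ : Measure (Fin d → ℝ≥0)) [IsFiniteMeasure μ]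
    (y : Fin d → ℕ) : mixLik μ y ≠ ∞ :=
  ne_top_of_le_ne_top (measure_ne_top μ Set.univ) ((ENNReal.le_tsum y).trans_eq (tsum_mixLik μ))

theorem mixLik_add_single {d : ℕ} (μ : Measure (Fin d → ℝ≥0)) (y : Fin d → ℕ) (j : Fin d) :
    ((y j : ℝ≥0∞) + 1) * mixLik μ (y + Pi.single j 1) =
      ∫⁻ θ, (θ j : ℝ≥0∞) * poissonLik θ y ∂μ := by
  unfold mixLik
  rw [← lintegral_const_mul _ (measurable_poissonLik _)]
  simp_rw [poissonLik_add_single]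

theorem bayesEst_eq_postMean {d : ℕ} (G : Prior d) (y : Fin d → ℕ) (j : Fin d) :
    bayesEst G y j = postMean (G : Measure (Fin d → ℝ≥0)) y j := by
  unfold bayesEst postMean
  rw [← mixLik_add_single, mixture_apply, ENNReal.toReal_div, ENNReal.toReal_mul]
  congr 2

/-- If the mixing measure is supported on `θ j ≤ h`, then the posterior mean is at most `h`; the
inequality is stated without the division. -/
theorem succ_mul_mixLik_le {d : ℕ} {μ : Measure (Fin d → ℝ≥0)} [IsFiniteMeasure μ]
    {h : ℝ} {j : Fin d} (hμ : ∀ᵐ θ ∂μ, (θ j : ℝ) ≤ h) (y : Fin d → ℕ) :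
    ((y j : ℝ) + 1) * (mixLik μ (y + Pi.single j 1)).toReal ≤ h * (mixLik μ y).toReal := by
  by_cases h0 : 0 ≤ h
  · have h1 : ((y j : ℝ≥0∞) + 1) * mixLik μ (y + Pi.single j 1) ≤
        ENNReal.ofReal h * mixLik μ y := by
      rw [mixLik_add_single, mixLik, ← lintegral_const_mul _ (measurable_poissonLik y)]
      refine lintegral_mono_ae (hμ.mono fun θ hθ => ?_)
      gcongr
      rw [← ENNReal.ofReal_coe_nnreal]
      exact ENNReal.ofReal_le_ofReal hθ
    have h2 := ENNReal.toReal_mono (ENNReal.mul_ne_top ENNReal.ofReal_ne_top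
      (mixLik_ne_top μ y)) h1
    rw [ENNReal.toReal_mul, ENNReal.toReal_mul, ENNReal.toReal_ofReal h0] at h2
    convert h2 using 2
    rw [ENNReal.toReal_add (by simp) (by simp)]; simp
  · have : μ = 0 := by
      rw [← ae_eq_bot, ← Filter.eventually_false_iff_eq_bot]
      exact hμ.mono fun θ hθ => h0 ((θ j).2.trans hθ)
    subst this
    simp [mixLik]

theorem postMean_nonneg {d : ℕ} (μ : Measure (Fin d → ℝ≥0)) (y : Fin d → ℕ)
    (j : Fin d) : 0 ≤ postMean μ y j := by
  unfold postMean; positivity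

theorem postMean_le {d : ℕ} {μ : Measure (Fin d → ℝ≥0)} [IsFiniteMeasure μ]
    {h : ℝ} (h0 : 0 ≤ h) {j : Fin d} (hμ : ∀ᵐ θ ∂μ, (θ j : ℝ) ≤ h)
    (y : Fin d → ℕ) : postMean μ y j ≤ h :=
  div_le_of_le_mul₀ ENNReal.toReal_nonneg h0 (succ_mul_mixLik_le hμ y)

/-- The division in `postMean` is harmless: where the mixture vanishes, so does the numerator. -/
theorem postMean_mul_mixLik {d : ℕ} (μ : Measure (Fin d → ℝ≥0)) [IsFiniteMeasure μ]
    (y : Fin d → ℕ) (j : Fin d) :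
    postMean μ y j * (mixLik μ y).toReal =
      ((y j : ℝ) + 1) * (mixLik μ (y + Pi.single j 1)).toReal := by
  unfold postMean
  refine div_mul_cancel_of_imp fun h0 => ?_
  have h1 : mixLik μ y = 0 := by
    simpa [ENNReal.toReal_eq_zero_iff, mixLik_ne_top] using h0
  have h2 := mixLik_add_single μ y j
  rw [mixLik, lintegral_eq_zero_iff (measurable_poissonLik y)] at h1
  rw [lintegral_congr_ae (g := 0) (h1.mono fun θ hθ => by simp at hθ; simp [hθ])] at h2
  simp at h2
  simp [h2]

/-! ### Comparing posterior means by the Hellinger distance of the mixtures -/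

theorem sq_sub_le_mul_sq_sqrt_sub {u v : ℝ} (hu : 0 ≤ u) (hv : 0 ≤ v) :
    (u - v) ^ 2 ≤ 2 * (√u - √v) ^ 2 * (u + v) := by
  have h1 := Real.sq_sqrt hu
  have h2 := Real.sq_sqrt hv
  have h3 : (u - v) ^ 2 = (√u - √v) ^ 2 * (√u + √v) ^ 2 := by
    rw [← mul_pow]; congr 1; nlinarith
  have h4 : (√u + √v) ^ 2 ≤ 2 * (u + v) := by nlinarith [sq_nonneg (√u - √v)]
  rw [h3]
  nlinarith [mul_le_mul_of_nonneg_left h4 (sq_nonneg (√u - √v))]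

/-- Comparison of two ratios bounded by `h`. The differences of `m / u` and of `n / v` from the
symmetrized ratios `2 * m / (u + v)` and `2 * n / (u + v)` are controlled by `u - v`. -/
theorem mul_sq_div_sub_div_le {u v m n h : ℝ} (hu : 0 ≤ u) (hv : 0 ≤ v)
    (hm : 0 ≤ m) (hn : 0 ≤ n) (hmu : m ≤ h * u) (hnv : n ≤ h * v) :
    u * (m / u - n / v) ^ 2 ≤ 16 * h ^ 2 * (√u - √v) ^ 2 + 8 * ((m - n) ^ 2 / (u + v)) := by
  rcases hu.eq_or_lt with rfl | hu
  · simp only [zero_mul]; positivity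
  rcases hv.eq_or_lt with rfl | hv
  · -- Here the junk value `n / 0 = 0` is the right one, since `n ≤ h * 0`.
    have h1 : u * (m / u - n / 0) ^ 2 ≤ h ^ 2 * u := by
      have : m / u ≤ h := (div_le_iff₀ hu).2 hmu
      have : (m / u) ^ 2 ≤ h ^ 2 := by gcongr
      rw [div_zero, sub_zero]
      nlinarith
    have h2 : (√u - √0) ^ 2 = u := by simp [Real.sq_sqrt hu.le]
    have h3 : 0 ≤ (m - n) ^ 2 / (u + 0) := by positivity
    rw [h2]
    nlinarith [mul_nonneg (sq_nonneg h) hu.le]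
  have hs : 0 < u + v := by positivity
  have hα : |m / u| ≤ h := by
    rw [abs_of_nonneg (by positivity)]; exact (div_le_iff₀ hu).2 hmu
  have hβ : |n / v| ≤ h := by
    rw [abs_of_nonneg (by positivity)]; exact (div_le_iff₀ hv).2 hnv
  have e1 : m / u - n / v = (m / u + n / v) * ((v - u) / (u + v)) + 2 * ((m - n) / (u + v)) := by
    field_simp; ring
  have e2 : (m / u + n / v) ^ 2 ≤ 4 * h ^ 2 := by
    have := abs_le.1 hα
    have := abs_le.1 hβ
    nlinarith
  have e3 : (m / u - n / v) ^ 2 ≤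
      8 * h ^ 2 * ((v - u) / (u + v)) ^ 2 + 8 * ((m - n) / (u + v)) ^ 2 := by
    rw [e1]
    nlinarith [sq_nonneg ((m / u + n / v) * ((v - u) / (u + v)) - 2 * ((m - n) / (u + v))),
      mul_le_mul_of_nonneg_right e2 (sq_nonneg ((v - u) / (u + v)))]
  have e4 : (v - u) ^ 2 / (u + v) ≤ 2 * (√u - √v) ^ 2 := by
    rw [div_le_iff₀ hs]
    calc (v - u) ^ 2 = (u - v) ^ 2 := by ring
      _ ≤ _ := sq_sub_le_mul_sq_sqrt_sub hu.le hv.le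
  calc u * (m / u - n / v) ^ 2 ≤ (u + v) * (m / u - n / v) ^ 2 := by
        gcongr; linarith
    _ ≤ (u + v) * (8 * h ^ 2 * ((v - u) / (u + v)) ^ 2 + 8 * ((m - n) / (u + v)) ^ 2) := by
        gcongr
    _ = 8 * h ^ 2 * ((v - u) ^ 2 / (u + v)) + 8 * ((m - n) ^ 2 / (u + v)) := by
        field_simp
    _ ≤ 8 * h ^ 2 * (2 * (√u - √v) ^ 2) + 8 * ((m - n) ^ 2 / (u + v)) := by gcongr
    _ = _ := by ring

noncomputable section

/-- Squared Hellinger distance of two nonnegative functions, which need not be probability mass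
functions. -/
def hellSq {α : Type*} (u v : α → ℝ≥0∞) : ℝ≥0∞ :=
  ∑' y, ENNReal.ofReal ((√(u y).toReal - √(v y).toReal) ^ 2)

end

theorem hellSq_comm {α : Type*} (u v : α → ℝ≥0∞) : hellSq u v = hellSq v u := by
  unfold hellSq
  refine tsum_congr fun y => ?_
  congr 1
  ring

theorem hellSq_triangle {α : Type*} (u v w : α → ℝ≥0∞) :
    hellSq u w ≤ 2 * hellSq u v + 2 * hellSq v w := by
  unfold hellSq
  rw [← ENNReal.tsum_mul_left, ← ENNReal.tsum_mul_left, ← ENNReal.tsum_add]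
  refine ENNReal.tsum_le_tsum fun y => ?_
  have h2 : (2 : ℝ≥0∞) = ENNReal.ofReal 2 := by simp
  rw [h2, ← ENNReal.ofReal_mul (by norm_num), ← ENNReal.ofReal_mul (by norm_num),
    ← ENNReal.ofReal_add (by positivity) (by positivity)]
  refine ENNReal.ofReal_le_ofReal ?_
  nlinarith [sq_nonneg ((√(u y).toReal - √(v y).toReal) - (√(v y).toReal - √(w y).toReal))]

/-- If `w = u + r` then the squared Hellinger distance of `u` and `w` is at most the mass of `r`. -/
theorem hellSq_le_tsum_of_eq_add {α : Type*} {u w r : α → ℝ≥0∞} (h : ∀ y, w y = u y + r y)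
    (hw : ∀ y, w y ≠ ∞) : hellSq u w ≤ ∑' y, r y := by
  unfold hellSq
  refine ENNReal.tsum_le_tsum fun y => ?_
  have hu : u y ≠ ∞ := fun h' => hw y (by simp [h, h'])
  have hr : r y ≠ ∞ := fun h' => hw y (by simp [h, h'])
  refine ENNReal.ofReal_le_of_le_toReal ?_
  rw [h, ENNReal.toReal_add hu hr]
  have h1 : √((u y).toReal) ≤ √((u y).toReal + (r y).toReal) :=
    Real.sqrt_le_sqrt (by linarith [ENNReal.toReal_nonneg (a := r y)])
  have h2 := Real.sq_sqrt (ENNReal.toReal_nonneg (a := u y))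
  have h3 := Real.sq_sqrt (add_nonneg (ENNReal.toReal_nonneg (a := u y))
    (ENNReal.toReal_nonneg (a := r y)))
  nlinarith [Real.sqrt_nonneg (u y).toReal]

/-- Pointwise comparison of two posterior means by Hellinger increments at `y` and at `y + e j`. -/
theorem mixLik_mul_sq_postMean_sub_le {d : ℕ} {μ ν : Measure (Fin d → ℝ≥0)} [IsFiniteMeasure μ]
    [IsFiniteMeasure ν] {h : ℝ} (h0 : 0 ≤ h) {j : Fin d}
    (hμ : ∀ᵐ θ ∂μ, (θ j : ℝ) ≤ h) (hν : ∀ᵐ θ ∂ν, (θ j : ℝ) ≤ h) (y : Fin d → ℕ) :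
    (mixLik μ y).toReal * (postMean μ y j - postMean ν y j) ^ 2 ≤
      16 * h ^ 2 * (√(mixLik μ y).toReal - √(mixLik ν y).toReal) ^ 2 +
      16 * h * (y j + 1) * (√(mixLik μ (y + Pi.single j 1)).toReal -
        √(mixLik ν (y + Pi.single j 1)).toReal) ^ 2 := by
  have hm := succ_mul_mixLik_le hμ y
  have hn := succ_mul_mixLik_le hν y
  unfold postMean
  set u := (mixLik μ y).toReal
  set v := (mixLik ν y).toReal
  set u' := (mixLik μ (y + Pi.single j 1)).toReal
  set v' := (mixLik ν (y + Pi.single j 1)).toReal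
  have hu : 0 ≤ u := ENNReal.toReal_nonneg
  have hv : 0 ≤ v := ENNReal.toReal_nonneg
  have hu' : 0 ≤ u' := ENNReal.toReal_nonneg
  have hv' : 0 ≤ v' := ENNReal.toReal_nonneg
  have hk : (0 : ℝ) < y j + 1 := by positivity
  refine (mul_sq_div_sub_div_le hu hv (by positivity) (by positivity) hm hn).trans ?_
  have key : (((y j : ℝ) + 1) * u' - (y j + 1) * v') ^ 2 / (u + v) ≤
      2 * h * (y j + 1) * (√u' - √v') ^ 2 := by
    refine div_le_of_le_mul₀ (by positivity) (by positivity) ?_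
    calc (((y j : ℝ) + 1) * u' - (y j + 1) * v') ^ 2 = (y j + 1) ^ 2 * (u' - v') ^ 2 := by ring
      _ ≤ (y j + 1) ^ 2 * (2 * (√u' - √v') ^ 2 * (u' + v')) := by
          gcongr; exact sq_sub_le_mul_sq_sqrt_sub hu' hv'
      _ = 2 * (y j + 1) * (√u' - √v') ^ 2 * ((y j + 1) * u' + (y j + 1) * v') := by ring
      _ ≤ 2 * (y j + 1) * (√u' - √v') ^ 2 * (h * u + h * v) := by gcongr
      _ = _ := by ring
  linarith

theorem abs_postMean_sub_le {d : ℕ} {μ ν : Measure (Fin d → ℝ≥0)} [IsFiniteMeasure μ]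
    [IsFiniteMeasure ν] {h : ℝ} (h0 : 0 ≤ h) {j : Fin d}
    (hμ : ∀ᵐ θ ∂μ, (θ j : ℝ) ≤ h) (hν : ∀ᵐ θ ∂ν, (θ j : ℝ) ≤ h) (y : Fin d → ℕ) :
    |postMean μ y j - postMean ν y j| ≤ h :=
  abs_sub_le_of_nonneg_of_le (postMean_nonneg μ y j) (postMean_le h0 hμ y)
    (postMean_nonneg ν y j) (postMean_le h0 hν y)

theorem ofReal_mul_eq_ofReal_mul_toReal {x : ℝ} (hx : 0 ≤ x) {u : ℝ≥0∞} (hu : u ≠ ∞) :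
    ENNReal.ofReal x * u = ENNReal.ofReal (u.toReal * x) := by
  rw [mul_comm u.toReal, ENNReal.ofReal_mul hx, ENNReal.ofReal_toReal hu]

/-- The squared distance of two posterior means bounded by `h` is controlled by the Hellinger
distance of the mixtures, up to the mass of the mixture beyond a level `K`. -/
theorem tsum_sq_postMean_sub_le {d : ℕ} {μ ν : Measure (Fin d → ℝ≥0)} [IsFiniteMeasure μ]
    [IsFiniteMeasure ν] {h : ℝ} (h0 : 0 ≤ h) {j : Fin d} (hμ : ∀ᵐ θ ∂μ, (θ j : ℝ) ≤ h)
    (hν : ∀ᵐ θ ∂ν, (θ j : ℝ) ≤ h) (K : ℕ) :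
    ∑' y, ENNReal.ofReal ((postMean μ y j - postMean ν y j) ^ 2) * mixLik μ y ≤
      ENNReal.ofReal (16 * h ^ 2 + 16 * h * K) * hellSq (mixLik μ) (mixLik ν) +
        ENNReal.ofReal (h ^ 2) * ∑' y, {y : Fin d → ℕ | K ≤ y j}.indicator (mixLik μ) y := by
  set D : (Fin d → ℕ) → ℝ≥0∞ := fun y =>
    ENNReal.ofReal ((√(mixLik μ y).toReal - √(mixLik ν y).toReal) ^ 2) with hD
  have hshift : ∑' y, D (y + Pi.single j 1) ≤ ∑' y, D y :=
    ENNReal.tsum_comp_le_tsum_of_injective (add_left_injective (Pi.single j 1)) D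
  have hpt : ∀ y, ENNReal.ofReal ((postMean μ y j - postMean ν y j) ^ 2) * mixLik μ y ≤
      ENNReal.ofReal (16 * h ^ 2) * D y + ENNReal.ofReal (16 * h * K) * D (y + Pi.single j 1) +
        ENNReal.ofReal (h ^ 2) * {y : Fin d → ℕ | K ≤ y j}.indicator (mixLik μ) y := by
    intro y
    by_cases hy : K ≤ y j
    · refine le_trans ?_ le_add_self
      rw [Set.indicator_of_mem (by exact hy)]
      gcongr ENNReal.ofReal ?_ * _
      exact sq_le_sq.2 ((abs_postMean_sub_le h0 hμ hν y).trans (le_abs_self h))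
    · have hyK : (y j : ℝ) + 1 ≤ K := by exact_mod_cast not_le.1 hy
      rw [Set.indicator_of_notMem (by exact hy), mul_zero, add_zero, hD,
        ← ENNReal.ofReal_mul (by positivity), ← ENNReal.ofReal_mul (by positivity),
        ← ENNReal.ofReal_add (by positivity) (by positivity),
        ofReal_mul_eq_ofReal_mul_toReal (sq_nonneg _) (mixLik_ne_top μ y)]
      refine ENNReal.ofReal_le_ofReal ((mixLik_mul_sq_postMean_sub_le h0 hμ hν y).trans ?_)
      gcongr
  refine (ENNReal.tsum_le_tsum hpt).trans ?_
  rw [ENNReal.tsum_add, ENNReal.tsum_add, ENNReal.tsum_mul_left, ENNReal.tsum_mul_left,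
    ENNReal.tsum_mul_left, ENNReal.ofReal_add (by positivity) (by positivity), add_mul]
  gcongr
  · exact le_rfl
  · exact hshift

/-! ### Perturbing the mixing measure -/

theorem mixLik_add {d : ℕ} (μ ρ : Measure (Fin d → ℝ≥0)) (y : Fin d → ℕ) :
    mixLik (μ + ρ) y = mixLik μ y + mixLik ρ y :=
  lintegral_add_measure _ _ _

/-- Jensen's inequality for the posterior mean: its square is at most the posterior second
moment. -/
theorem sq_postMean_mul_mixLik_le {d : ℕ} (ρ : Measure (Fin d → ℝ≥0)) [IsFiniteMeasure ρ]
    (y : Fin d → ℕ) (j : Fin d) :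
    ENNReal.ofReal (postMean ρ y j ^ 2) * mixLik ρ y ≤
      ∫⁻ θ, (θ j : ℝ≥0∞) ^ 2 * poissonLik θ y ∂ρ := by
  set c : ℝ≥0 := (postMean ρ y j).toNNReal
  have hcr : (c : ℝ) = postMean ρ y j := Real.coe_toNNReal _ (postMean_nonneg ρ y j)
  have hc2 : ENNReal.ofReal (postMean ρ y j ^ 2) = (c : ℝ≥0∞) ^ 2 := by
    rw [← hcr, ENNReal.ofReal_pow (by positivity), ENNReal.ofReal_coe_nnreal]
  -- `c` is the posterior mean itself, so that `∫ θ j * lik = c * ∫ lik`.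
  have hmean : ∫⁻ θ, (θ j : ℝ≥0∞) * poissonLik θ y ∂ρ = c * mixLik ρ y := by
    rw [← mixLik_add_single]
    refine (ENNReal.toReal_eq_toReal_iff' ?_ ?_).1 ?_
    · exact ENNReal.mul_ne_top (by simp) (mixLik_ne_top ρ _)
    · exact ENNReal.mul_ne_top (by simp) (mixLik_ne_top ρ _)
    · rw [ENNReal.toReal_mul, ENNReal.toReal_mul, ENNReal.coe_toReal, hcr, postMean_mul_mixLik,
        ENNReal.toReal_add (by simp) (by simp)]
      simp
  have hfin : (c : ℝ≥0∞) ^ 2 * mixLik ρ y ≠ ∞ :=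
    ENNReal.mul_ne_top (by simp) (mixLik_ne_top ρ y)
  rw [hc2]
  have h1 : 2 * c * ∫⁻ θ, (θ j : ℝ≥0∞) * poissonLik θ y ∂ρ ≤
      (∫⁻ θ, (θ j : ℝ≥0∞) ^ 2 * poissonLik θ y ∂ρ) + c ^ 2 * mixLik ρ y := by
    have hl := measurable_poissonLik y
    have hθ : Measurable fun θ : Fin d → ℝ≥0 => (θ j : ℝ≥0∞) := by fun_prop
    rw [mixLik, ← lintegral_const_mul _ (show Measurable fun θ : Fin d → ℝ≥0 =>
      (θ j : ℝ≥0∞) * poissonLik θ y from hθ.mul hl), ← lintegral_const_mul _ hl,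
      ← lintegral_add_right _ (hl.const_mul _)]
    refine lintegral_mono fun θ => ?_
    rw [← mul_assoc, ← add_mul]
    gcongr
    have : 2 * c * θ j ≤ θ j ^ 2 + c ^ 2 := by
      rw [← NNReal.coe_le_coe]
      push_cast
      nlinarith [sq_nonneg ((θ j : ℝ) - c)]
    have := ENNReal.coe_le_coe.2 this
    push_cast at this
    exact this
  rw [hmean, show 2 * (c : ℝ≥0∞) * (c * mixLik ρ y) = c ^ 2 * mixLik ρ y + c ^ 2 * mixLik ρ y by
    ring] at h1
  exact (ENNReal.add_le_add_iff_right hfin).1 h1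

/-- The effect on the posterior mean of adding a perturbation `ρ` to a mixing measure supported on
`θ j ≤ h`: the new posterior mean is the average of the posterior means of the two parts, weighted
by their likelihoods. -/
theorem tsum_sq_postMean_sub_postMean_add_le {d : ℕ} {μ ρ : Measure (Fin d → ℝ≥0)}
    [IsFiniteMeasure μ] [IsFiniteMeasure ρ] {h : ℝ} (h0 : 0 ≤ h) {j : Fin d}
    (hμ : ∀ᵐ θ ∂μ, (θ j : ℝ) ≤ h) :
    ∑' y, ENNReal.ofReal ((postMean μ y j - postMean (μ + ρ) y j) ^ 2) * mixLik (μ + ρ) y ≤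
      (∫⁻ θ, (θ j : ℝ≥0∞) ^ 2 ∂ρ) + ENNReal.ofReal (h ^ 2) * ρ Set.univ := by
  have hpt : ∀ y, ENNReal.ofReal ((postMean μ y j - postMean (μ + ρ) y j) ^ 2) *
      mixLik (μ + ρ) y ≤ (∫⁻ θ, (θ j : ℝ≥0∞) ^ 2 * poissonLik θ y ∂ρ) +
        ENNReal.ofReal (h ^ 2) * mixLik ρ y := by
    intro y
    refine le_trans ?_ (add_le_add_left (sq_postMean_mul_mixLik_le ρ y j) _)
    rw [← add_mul, ← ENNReal.ofReal_add (by positivity) (by positivity),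
      ofReal_mul_eq_ofReal_mul_toReal (sq_nonneg _) (mixLik_ne_top _ y),
      ofReal_mul_eq_ofReal_mul_toReal (by positivity) (mixLik_ne_top _ y)]
    refine ENNReal.ofReal_le_ofReal ?_
    have e1 := postMean_mul_mixLik μ y j
    have e2 := postMean_mul_mixLik ρ y j
    have e3 := postMean_mul_mixLik (μ + ρ) y j
    rw [mixLik_add, mixLik_add, ENNReal.toReal_add (mixLik_ne_top μ _) (mixLik_ne_top ρ _),
      ENNReal.toReal_add (mixLik_ne_top μ _) (mixLik_ne_top ρ _), mul_add ((y j : ℝ) + 1),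
      ← e1, ← e2] at e3
    rw [mixLik_add, ENNReal.toReal_add (mixLik_ne_top μ _) (mixLik_ne_top ρ _)]
    have ha0 := postMean_nonneg μ y j
    have hah := postMean_le h0 hμ y
    have hc0 := postMean_nonneg ρ y j
    have hu : 0 ≤ (mixLik μ y).toReal := ENNReal.toReal_nonneg
    have hr : 0 ≤ (mixLik ρ y).toReal := ENNReal.toReal_nonneg
    generalize postMean μ y j = a at *
    generalize postMean ρ y j = c at *
    generalize postMean (μ + ρ) y j = w at *
    generalize (mixLik μ y).toReal = u at *
    generalize (mixLik ρ y).toReal = r at *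
    have hsq : (a - c) ^ 2 ≤ c ^ 2 + h ^ 2 := by nlinarith
    rcases (add_nonneg hu hr).eq_or_lt with h' | hs
    · rw [← h']; simp only [zero_mul]; positivity
    · have hw : (a - w) * (u + r) = (a - c) * r := by linarith
      have : (u + r) * (a - w) ^ 2 ≤ r * (a - c) ^ 2 := by
        have h2 : (u + r) * ((u + r) * (a - w) ^ 2) = r * (r * (a - c) ^ 2) := by
          calc _ = ((a - w) * (u + r)) ^ 2 := by ring
            _ = _ := by rw [hw]; ring
        have h3 : r * (r * (a - c) ^ 2) ≤ (u + r) * (r * (a - c) ^ 2) := by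
          gcongr; linarith
        exact le_of_mul_le_mul_left (h2.trans_le h3) hs
      calc _ ≤ r * (a - c) ^ 2 := this
        _ ≤ r * (c ^ 2 + h ^ 2) := by gcongr
  refine (ENNReal.tsum_le_tsum hpt).trans_eq ?_
  have hθ : Measurable fun θ : Fin d → ℝ≥0 => (θ j : ℝ≥0∞) := by fun_prop
  rw [ENNReal.tsum_add, ENNReal.tsum_mul_left, tsum_mixLik,
    ← lintegral_tsum fun y => show AEMeasurable (fun θ : Fin d → ℝ≥0 =>
      (θ j : ℝ≥0∞) ^ 2 * poissonLik θ y) ρ from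
        ((hθ.pow_const 2).mul (measurable_poissonLik y)).aemeasurable]
  simp_rw [ENNReal.tsum_mul_left, tsum_poissonLik, mul_one]

theorem ofReal_sq_sub_le (x y z : ℝ) : ENNReal.ofReal ((x - z) ^ 2) ≤
    2 * ENNReal.ofReal ((x - y) ^ 2) + 2 * ENNReal.ofReal ((y - z) ^ 2) := by
  have h2 : (2 : ℝ≥0∞) = ENNReal.ofReal 2 := by simp
  rw [h2, ← ENNReal.ofReal_mul (by norm_num), ← ENNReal.ofReal_mul (by norm_num),
    ← ENNReal.ofReal_add (by positivity) (by positivity)]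
  refine ENNReal.ofReal_le_ofReal ?_
  nlinarith [sq_nonneg ((x - y) - (y - z))]

/-- The posterior mean under the true mixing measure `μ + ρ` may be replaced by the one under its
main part `μ`, which is bounded by `h`. -/
theorem tsum_sq_postMean_sub_le_two_mul {d : ℕ} {μ ρ ν : Measure (Fin d → ℝ≥0)}
    [IsFiniteMeasure μ] [IsFiniteMeasure ρ] {h : ℝ} (h0 : 0 ≤ h) {j : Fin d}
    (hμ : ∀ᵐ θ ∂μ, (θ j : ℝ) ≤ h) :
    ∑' y, ENNReal.ofReal ((postMean ν y j - postMean (μ + ρ) y j) ^ 2) * mixLik (μ + ρ) y ≤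
      2 * ∑' y, ENNReal.ofReal ((postMean μ y j - postMean ν y j) ^ 2) * mixLik (μ + ρ) y +
        2 * ((∫⁻ θ, (θ j : ℝ≥0∞) ^ 2 ∂ρ) + ENNReal.ofReal (h ^ 2) * ρ Set.univ) := by
  refine le_trans ?_ (add_le_add_right
    (mul_le_mul_right (tsum_sq_postMean_sub_postMean_add_le (ρ := ρ) h0 hμ) 2) _)
  rw [← ENNReal.tsum_mul_left, ← ENNReal.tsum_mul_left, ← ENNReal.tsum_add]
  refine ENNReal.tsum_le_tsum fun y => ?_
  rw [← mul_assoc, ← mul_assoc, ← add_mul]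
  gcongr
  have := ofReal_sq_sub_le (postMean ν y j) (postMean μ y j) (postMean (μ + ρ) y j)
  rwa [show (postMean ν y j - postMean μ y j) ^ 2 = (postMean μ y j - postMean ν y j) ^ 2 by
    ring] at this

/-- Regret bound when the estimated mixing measure `ν` and the main part `μ` of the true one are
supported on `θ j ≤ h`. -/
theorem tsum_sq_postMean_sub_le_hellSq {d : ℕ} {μ ρ ν : Measure (Fin d → ℝ≥0)}
    [IsFiniteMeasure μ] [IsFiniteMeasure ρ] [IsFiniteMeasure ν] {h : ℝ} (h0 : 0 ≤ h) {j : Fin d}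
    (hμ : ∀ᵐ θ ∂μ, (θ j : ℝ) ≤ h) (hν : ∀ᵐ θ ∂ν, (θ j : ℝ) ≤ h) (K : ℕ) :
    ∑' y, ENNReal.ofReal ((postMean ν y j - postMean (μ + ρ) y j) ^ 2) * mixLik (μ + ρ) y ≤
      ENNReal.ofReal (64 * h ^ 2 + 64 * h * K) *
          (hellSq (mixLik (μ + ρ)) (mixLik ν) + ρ Set.univ) +
        2 * ENNReal.ofReal (h ^ 2) *
          ∑' y, {y : Fin d → ℕ | K ≤ y j}.indicator (mixLik (μ + ρ)) y +
        4 * ENNReal.ofReal (h ^ 2) * ρ Set.univ + 2 * ∫⁻ θ, (θ j : ℝ≥0∞) ^ 2 ∂ρ := by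
  refine (tsum_sq_postMean_sub_le_two_mul h0 hμ).trans ?_
  have h1 := tsum_sq_postMean_sub_le h0 hμ hν K
  have h2 : ∑' y, ENNReal.ofReal ((postMean μ y j - postMean ν y j) ^ 2) * mixLik ρ y ≤
      ENNReal.ofReal (h ^ 2) * ρ Set.univ := by
    rw [← tsum_mixLik, ← ENNReal.tsum_mul_left]
    refine ENNReal.tsum_le_tsum fun y => ?_
    gcongr ENNReal.ofReal ?_ * _
    exact sq_le_sq.2 ((abs_postMean_sub_le h0 hμ hν y).trans (le_abs_self h))
  have h3 : hellSq (mixLik μ) (mixLik ν) ≤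
      2 * (hellSq (mixLik (μ + ρ)) (mixLik ν) + ρ Set.univ) := by
    refine (hellSq_triangle _ (mixLik (μ + ρ)) _).trans ?_
    have := hellSq_le_tsum_of_eq_add (u := mixLik μ) (mixLik_add μ ρ) (mixLik_ne_top (μ + ρ))
    rw [tsum_mixLik] at this
    rw [mul_add, add_comm]
    gcongr
  have h4 : ∑' y, {y : Fin d → ℕ | K ≤ y j}.indicator (mixLik μ) y ≤
      ∑' y, {y : Fin d → ℕ | K ≤ y j}.indicator (mixLik (μ + ρ)) y := by
    refine ENNReal.tsum_le_tsum fun y => Set.indicator_le_indicator ?_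
    rw [mixLik_add]
    exact le_self_add
  have h5 : ENNReal.ofReal (64 * h ^ 2 + 64 * h * K) =
      2 * (ENNReal.ofReal (16 * h ^ 2 + 16 * h * K) * 2) := by
    have e2 : (2 : ℝ≥0∞) = ENNReal.ofReal 2 := by simp
    rw [e2, ← ENNReal.ofReal_mul (by positivity), ← ENNReal.ofReal_mul (by norm_num)]
    congr 1; ring
  have h6 : ∑' y, ENNReal.ofReal ((postMean μ y j - postMean ν y j) ^ 2) * mixLik (μ + ρ) y =
      ∑' y, ENNReal.ofReal ((postMean μ y j - postMean ν y j) ^ 2) * mixLik μ y +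
        ∑' y, ENNReal.ofReal ((postMean μ y j - postMean ν y j) ^ 2) * mixLik ρ y := by
    simp_rw [mixLik_add μ ρ, mul_add, ENNReal.tsum_add]
  rw [h5, h6]
  calc _ ≤ 2 * (ENNReal.ofReal (16 * h ^ 2 + 16 * h * K) *
          (2 * (hellSq (mixLik (μ + ρ)) (mixLik ν) + ρ Set.univ)) +
        ENNReal.ofReal (h ^ 2) *
          ∑' y, {y : Fin d → ℕ | K ≤ y j}.indicator (mixLik (μ + ρ)) y +
        ENNReal.ofReal (h ^ 2) * ρ Set.univ) +
      2 * ((∫⁻ θ, (θ j : ℝ≥0∞) ^ 2 ∂ρ) + ENNReal.ofReal (h ^ 2) * ρ Set.univ) := by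
        gcongr
        refine h1.trans ?_
        gcongr
    _ = _ := by ring

/-- Crude regret bound, for samples on which the estimated mixing measure may have a large
support. -/
theorem tsum_sq_postMean_sub_le_sq_add_sq {d : ℕ} {μ ρ ν : Measure (Fin d → ℝ≥0)}
    [IsFiniteMeasure μ] [IsFiniteMeasure ρ] [IsFiniteMeasure ν] [IsProbabilityMeasure (μ + ρ)]
    {h v : ℝ} (h0 : 0 ≤ h) (v0 : 0 ≤ v) {j : Fin d}
    (hμ : ∀ᵐ θ ∂μ, (θ j : ℝ) ≤ h) (hν : ∀ᵐ θ ∂ν, (θ j : ℝ) ≤ v) :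
    ∑' y, ENNReal.ofReal ((postMean ν y j - postMean (μ + ρ) y j) ^ 2) * mixLik (μ + ρ) y ≤
      2 * ENNReal.ofReal (v ^ 2 + h ^ 2) +
        2 * ((∫⁻ θ, (θ j : ℝ≥0∞) ^ 2 ∂ρ) + ENNReal.ofReal (h ^ 2) * ρ Set.univ) := by
  refine (tsum_sq_postMean_sub_le_two_mul h0 hμ).trans ?_
  gcongr 2 * ?_ + _
  calc _ ≤ ∑' y, ENNReal.ofReal (v ^ 2 + h ^ 2) * mixLik (μ + ρ) y := by
        refine ENNReal.tsum_le_tsum fun y => ?_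
        gcongr
        have := postMean_nonneg μ y j
        have := postMean_nonneg ν y j
        have := postMean_le h0 hμ y
        have := postMean_le v0 hν y
        nlinarith
    _ = _ := by rw [ENNReal.tsum_mul_left, tsum_mixLik, measure_univ, mul_one]

/-! ### The support of an unconstrained minimum-distance estimate -/

theorem empirical_apply_toReal {d n : ℕ} [NeZero n] (Y : Fin n → Fin d → ℕ) (y : Fin d → ℕ) :
    (empirical Y y).toReal = (∑ i, if Y i = y then (1 : ℝ) else 0) / n := by
  classical
  unfold empirical
  rw [PMF.map_apply, tsum_fintype, ENNReal.toReal_sum (by intro i _; split_ifs <;> simp [NeZero.ne n]),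
    Finset.sum_div]
  refine Finset.sum_congr rfl fun i _ => ?_
  by_cases h : Y i = y
  · rw [if_pos h.symm, if_pos h]; simp
  · rw [if_neg (Ne.symm h), if_neg h]; simp

theorem empirical_ne_zero_iff {d n : ℕ} [NeZero n] (Y : Fin n → Fin d → ℕ) (y : Fin d → ℕ) :
    empirical Y y ≠ 0 ↔ ∃ i, Y i = y := by
  rw [← PMF.mem_support_iff]
  simp [empirical]

/-- The Poisson likelihood of `y ≤ m` is strictly decreasing in the mean beyond `m`. -/
theorem exp_neg_mul_pow_lt {t : ℝ} {m y : ℕ} (hy : y ≤ m) (ht : (m : ℝ) < t) :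
    Real.exp (-t) * t ^ y < Real.exp (-(m : ℝ)) * (m : ℝ) ^ y := by
  rcases Nat.eq_zero_or_pos m with rfl | hm
  · obtain rfl : y = 0 := by omega
    simpa using ht
  have hm' : (0 : ℝ) < m := by exact_mod_cast hm
  have h1 : (t / m) ^ y < Real.exp (t - m) := by
    have ht0 : 0 < t := hm'.trans ht
    calc (t / m) ^ y ≤ (t / m) ^ m :=
          pow_le_pow_right₀ ((one_le_div hm').2 ht.le) hy
      _ < Real.exp (t / m - 1) ^ m := by
          refine pow_lt_pow_left₀ ?_ (by positivity) hm.ne'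
          have := Real.add_one_lt_exp (x := t / m - 1) (sub_ne_zero.2 ((one_lt_div hm').2 ht).ne')
          linarith
      _ = Real.exp (t - m) := by
          rw [← Real.exp_nat_mul]
          congr 1
          field_simp
  have ht0 : 0 < t := hm'.trans ht
  calc Real.exp (-t) * t ^ y = Real.exp (-t) * (m : ℝ) ^ y * (t / m) ^ y := by
        rw [div_pow]; field_simp
    _ < Real.exp (-t) * (m : ℝ) ^ y * Real.exp (t - m) := by gcongr
    _ = _ := by
        rw [mul_right_comm, ← Real.exp_add]; congr 2; ring

theorem poissonLik_eq_ofReal_prod {d : ℕ} (θ : Fin d → ℝ≥0) (y : Fin d → ℕ) :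
    poissonLik θ y = ENNReal.ofReal
      (∏ j, Real.exp (-(θ j : ℝ)) * (θ j : ℝ) ^ y j / (Nat.factorial (y j) : ℝ)) := by
  rw [ENNReal.ofReal_prod_of_nonneg fun _ _ => by positivity, poissonLik]

theorem poissonLik_ne_zero_of_pos {d : ℕ} {θ : Fin d → ℝ≥0} {y : Fin d → ℕ}
    (h : ∀ j, θ j = 0 → y j = 0) : poissonLik θ y ≠ 0 := by
  rw [poissonLik_eq_ofReal_prod, ← pos_iff_ne_zero, ENNReal.ofReal_pos]
  refine Finset.prod_pos fun j _ => ?_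
  rcases eq_or_ne (θ j) 0 with h0 | h0
  · simp [h0, h j h0]
  · have : 0 < (θ j : ℝ) := by positivity
    positivity

theorem poissonLik_factor_le_inf {d : ℕ} (θ : Fin d → ℝ≥0) {y m : Fin d → ℕ} (hy : y ≤ m)
    (j : Fin d) : Real.exp (-(θ j : ℝ)) * (θ j : ℝ) ^ y j / (Nat.factorial (y j) : ℝ) ≤
      Real.exp (-(min (θ j) (m j) : ℝ≥0)) * (min (θ j) (m j) : ℝ≥0) ^ y j /
        (Nat.factorial (y j) : ℝ) := by
  rcases le_or_gt (θ j) (m j) with h | h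
  · rw [min_eq_left h]
  · rw [min_eq_right h.le]
    gcongr ?_ / _
    exact (exp_neg_mul_pow_lt (hy j) (by exact_mod_cast h)).le

/-- Decreasing to `m j` the means exceeding `m j` increases the likelihood of each `y ≤ m`. -/
theorem poissonLik_le_inf {d : ℕ} (θ : Fin d → ℝ≥0) {y m : Fin d → ℕ} (hy : y ≤ m) :
    poissonLik θ y ≤ poissonLik (fun j => min (θ j) (m j)) y := by
  rw [poissonLik_eq_ofReal_prod, poissonLik_eq_ofReal_prod]
  exact ENNReal.ofReal_le_ofReal (Finset.prod_le_prod (fun _ _ => by positivity)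
    fun j _ => poissonLik_factor_le_inf θ hy j)

theorem poissonLik_lt_inf {d : ℕ} {θ : Fin d → ℝ≥0} {y m : Fin d → ℕ} (hy : y ≤ m)
    (hpos : poissonLik (fun j => min (θ j) (m j)) y ≠ 0) {k : Fin d} (hk : (m k : ℝ≥0) < θ k) :
    poissonLik θ y < poissonLik (fun j => min (θ j) (m j)) y := by
  rcases eq_or_ne (poissonLik θ y) 0 with h0 | h0
  · rw [h0]; exact pos_iff_ne_zero.2 hpos
  rw [poissonLik_eq_ofReal_prod, ← pos_iff_ne_zero, ENNReal.ofReal_pos] at h0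
  rw [poissonLik_eq_ofReal_prod, poissonLik_eq_ofReal_prod, ENNReal.ofReal_lt_ofReal_iff']
  have hlt : (∏ j, Real.exp (-(θ j : ℝ)) * (θ j : ℝ) ^ y j / (Nat.factorial (y j) : ℝ)) <
      ∏ j, Real.exp (-(min (θ j) (m j) : ℝ≥0)) * (min (θ j) (m j) : ℝ≥0) ^ y j /
        (Nat.factorial (y j) : ℝ) := by
    refine Finset.prod_lt_prod (fun j _ => ?_) (fun j _ => poissonLik_factor_le_inf θ hy j)
      ⟨k, Finset.mem_univ k, ?_⟩
    · refine lt_of_le_of_ne (by positivity) fun h => ?_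
      exact h0.ne' (Finset.prod_eq_zero (Finset.mem_univ j) h.symm)
    · rw [min_eq_right hk.le]
      gcongr ?_ / _
      exact exp_neg_mul_pow_lt (hy k) (by exact_mod_cast hk)
  exact ⟨hlt, h0.trans hlt⟩

/-- Raising the model probabilities on the finite support of `p`, one of them strictly, strictly
decreases a decomposable distance from `p`. -/
theorem IsDecomposable.lt_of_le_of_lt {α : Type*} {dist : PMF α → PMF α → ℝ≥0∞}
    (hdist : IsDecomposable dist) {p q q' : PMF α} {s : Finset α} (hs : ∀ y, p y ≠ 0 ↔ y ∈ s)
    (hle : ∀ y ∈ s, q y ≤ q' y) (hlt : ∃ y ∈ s, q y < q' y) (hfin : dist p q ≠ ∞) :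
    dist p q' < dist p q := by
  classical
  obtain ⟨t, l, hsum, hanti, -, hzero⟩ := hdist
  have hval : ∀ r : PMF α, (dist p r : EReal) =
      (t p : EReal) + ∑ y ∈ s, l (p y).toReal (r y).toReal := by
    intro r
    obtain ⟨S, hS, hd⟩ := hsum p r
    have h0 : ∀ y ∉ s, l (p y).toReal (r y).toReal = 0 := by
      intro y hy
      have : p y = 0 := by
        by_contra h
        exact hy ((hs y).1 h)
      rw [this, ENNReal.toReal_zero]
      exact hzero _ ENNReal.toReal_nonneg
    rw [hd, hS.unique (hasSum_sum_of_ne_finset_zero h0)]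
  have hppos : ∀ y ∈ s, 0 < (p y).toReal := fun y hy =>
    ENNReal.toReal_pos ((hs y).2 hy) (p.apply_ne_top y)
  have hbot : ∀ r : PMF α, ∀ y ∈ s, l (p y).toReal (r y).toReal ≠ ⊥ := by
    intro r y hy h
    have h0 : 0 ≤ (r y).toReal := ENNReal.toReal_nonneg
    have := hanti _ (hppos y hy) (Set.mem_Ici.2 h0)
      (Set.mem_Ici.2 (by linarith : 0 ≤ (r y).toReal + 1)) (lt_add_one _)
    rw [h] at this
    exact not_lt_bot this
  have hcmp : ∀ y ∈ s, l (p y).toReal (q' y).toReal ≤ l (p y).toReal (q y).toReal := by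
    intro y hy
    exact (hanti _ (hppos y hy)).antitoneOn (Set.mem_Ici.2 ENNReal.toReal_nonneg)
      (Set.mem_Ici.2 ENNReal.toReal_nonneg) (ENNReal.toReal_mono (q'.apply_ne_top y) (hle y hy))
  -- finiteness of the distance makes every term of its decomposition finite
  have htop : ∀ y ∈ s, l (p y).toReal (q y).toReal ≠ ⊤ := by
    intro y hy h
    have hrest : ∑ x ∈ s.erase y, l (p x).toReal (q x).toReal ≠ ⊥ := by
      have : ∀ u : Finset α, u ⊆ s → ∑ x ∈ u, l (p x).toReal (q x).toReal ≠ ⊥ := by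
        intro u
        induction u using Finset.induction_on with
        | empty => intro _; simp
        | insert x u hx ih =>
          intro hu
          rw [Finset.sum_insert hx, Ne, EReal.add_eq_bot_iff, not_or]
          exact ⟨hbot q x (hu (Finset.mem_insert_self x u)),
            ih ((Finset.subset_insert x u).trans hu)⟩
      exact this _ (Finset.erase_subset y s)
    have hv := hval q
    rw [← Finset.add_sum_erase s _ hy, h, EReal.top_add_of_ne_bot hrest,
      EReal.coe_add_top] at hv
    exact hfin (EReal.coe_ennreal_eq_top_iff.1 hv)
  have htop' : ∀ y ∈ s, l (p y).toReal (q' y).toReal ≠ ⊤ := fun y hy h =>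
    htop y hy (top_le_iff.1 (h ▸ hcmp y hy))
  have hreal : ∀ r : PMF α, (∀ y ∈ s, l (p y).toReal (r y).toReal ≠ ⊤) →
      (dist p r : EReal) = ((t p + ∑ y ∈ s, (l (p y).toReal (r y).toReal).toReal : ℝ) : EReal) := by
    intro r hr
    have hcoe : ∀ (u : Finset α) (f : α → ℝ), ((∑ y ∈ u, f y : ℝ) : EReal) =
        ∑ y ∈ u, (f y : EReal) := by
      intro u f
      induction u using Finset.induction_on with
      | empty => simp
      | insert x u hx ih => rw [Finset.sum_insert hx, Finset.sum_insert hx, EReal.coe_add, ih]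
    rw [hval r, EReal.coe_add, hcoe]
    congr 1
    exact Finset.sum_congr rfl fun y hy => (EReal.coe_toReal (hr y hy) (hbot r y hy)).symm
  rw [← EReal.coe_ennreal_lt_coe_ennreal_iff, hreal q htop, hreal q' htop', EReal.coe_lt_coe_iff,
    add_lt_add_iff_left]
  refine Finset.sum_lt_sum (fun y hy => EReal.toReal_le_toReal (hcmp y hy) (hbot q' y hy)
    (htop y hy)) ?_
  obtain ⟨y, hy, hylt⟩ := hlt
  refine ⟨y, hy, ?_⟩
  rw [← EReal.coe_lt_coe_iff, EReal.coe_toReal (htop' y hy) (hbot q' y hy),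
    EReal.coe_toReal (htop y hy) (hbot q y hy)]
  exact hanti _ (hppos y hy) (Set.mem_Ici.2 ENNReal.toReal_nonneg)
    (Set.mem_Ici.2 ENNReal.toReal_nonneg) (ENNReal.toReal_strict_mono (q'.apply_ne_top y) hylt)

theorem chiSq_ne_top_of_pos {α : Type*} {p q : PMF α} {s : Finset α} (hs : ∀ y ∉ s, p y = 0)
    (hq : ∀ y, q y ≠ 0) : chiSq p q ≠ ∞ := by
  have hle : chiSq p q ≤ ∑' y, ((p y) ^ 2 / q y + q y) := by
    refine ENNReal.tsum_le_tsum fun y => ?_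
    have hp := p.apply_ne_top y
    have hqt := q.apply_ne_top y
    calc ENNReal.ofReal (((p y).toReal - (q y).toReal) ^ 2) / q y
        ≤ ENNReal.ofReal ((p y).toReal ^ 2 + (q y).toReal ^ 2) / q y := by
          gcongr
          nlinarith [mul_nonneg (ENNReal.toReal_nonneg (a := p y))
            (ENNReal.toReal_nonneg (a := q y))]
      _ = ((p y) ^ 2 + (q y) ^ 2) / q y := by
          rw [ENNReal.ofReal_add (by positivity) (by positivity),
            ENNReal.ofReal_pow ENNReal.toReal_nonneg, ENNReal.ofReal_pow ENNReal.toReal_nonneg,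
            ENNReal.ofReal_toReal hp, ENNReal.ofReal_toReal hqt]
      _ = _ := by
          rw [ENNReal.add_div, sq (q y), ENNReal.mul_div_cancel_right (hq y) hqt]
  refine ne_top_of_le_ne_top ?_ hle
  rw [ENNReal.tsum_add, q.tsum_coe, tsum_eq_sum (s := s) fun y hy => by simp [hs y hy]]
  refine ENNReal.add_ne_top.2 ⟨ENNReal.sum_ne_top.2 fun y _ => ?_, ENNReal.one_ne_top⟩
  exact ENNReal.div_ne_top (ENNReal.pow_ne_top (p.apply_ne_top y)) (hq y)

/-- The coordinatewise maximum of a sample. -/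
def sampleMax {d n : ℕ} (Y : Fin n → Fin d → ℕ) (j : Fin d) : ℕ :=
  Finset.univ.sup fun i => Y i j

theorem le_sampleMax {d n : ℕ} (Y : Fin n → Fin d → ℕ) (i : Fin n) : Y i ≤ sampleMax Y :=
  fun j => Finset.le_sup (f := fun i => Y i j) (Finset.mem_univ i)

/-- An unconstrained minimum-distance estimate is supported below the coordinatewise maximum `m`
of the sample: otherwise, moving the excess mass into the box below `m` would increase the
likelihood of the observations. -/
theorem ae_le_sampleMax_of_isMinDist {d n : ℕ} [NeZero n]
    {dist : PMF (Fin d → ℕ) → PMF (Fin d → ℕ) → ℝ≥0∞} (hdec : IsDecomposable dist) {a b : ℝ}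
    (hsand : IsSandwiched a b dist) {Y : Fin n → Fin d → ℕ} {Q : Prior d}
    (hQ : IsMinDist dist Set.univ (empirical Y) Q) :
    ∀ᵐ θ ∂(Q : Measure (Fin d → ℝ≥0)), ∀ j, (θ j : ℝ) ≤ sampleMax Y j := by
  classical
  set s : Finset (Fin d → ℕ) := Finset.univ.image Y with hs
  have hsupp : ∀ y, empirical Y y ≠ 0 ↔ y ∈ s := by
    intro y; rw [empirical_ne_zero_iff]; simp [hs]
  have hfin : dist (empirical Y) (mixture Q) ≠ ∞ := by
    -- A point mass at a positive mean gives every `y` positive probability.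
    set P : Prior d := diracProba fun _ => 1 with hP
    refine ne_top_of_le_ne_top ?_ (hQ.2 P trivial)
    refine ne_top_of_le_ne_top ?_ (hsand _ _).2
    refine ENNReal.mul_ne_top ENNReal.ofReal_ne_top (chiSq_ne_top_of_pos (s := s) ?_ fun y => ?_)
    · exact fun y hy => not_not.1 fun h => hy ((hsupp y).1 h)
    · rw [mixture_apply, mixLik]
      change ∫⁻ θ, poissonLik θ y ∂(Measure.dirac fun _ => 1) ≠ 0
      rw [lintegral_dirac' _ (measurable_poissonLik y)]
      exact poissonLik_ne_zero_of_pos fun j hj => absurd hj one_ne_zero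
  -- The transport truncates `θ`, except that a truncated `θ` under which the whole sample is
  -- impossible is moved to the maximum itself.
  set c : (Fin d → ℝ≥0) → Fin d → ℝ≥0 := fun θ j => min (θ j) (sampleMax Y j) with hc
  have hcm : Measurable c := by
    rw [hc]; fun_prop
  set T : (Fin d → ℝ≥0) → Fin d → ℝ≥0 := fun θ =>
    if ∃ i, poissonLik (c θ) (Y i) ≠ 0 then c θ else fun j => (sampleMax Y j : ℝ≥0) with hT
  have hTm : Measurable T := by
    refine Measurable.ite ?_ hcm measurable_const
    rw [Set.ofPred_exists]
    refine MeasurableSet.iUnion fun i => ?_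
    exact ((measurable_poissonLik (Y i)).comp hcm) (measurableSet_singleton 0).compl
  have hmaxpos : ∀ i, poissonLik (fun j => (sampleMax Y j : ℝ≥0)) (Y i) ≠ 0 := by
    intro i
    refine poissonLik_ne_zero_of_pos fun j hj => ?_
    have h1 := le_sampleMax Y i j
    have h2 : sampleMax Y j = 0 := by exact_mod_cast hj
    rw [h2] at h1
    exact Nat.le_zero.1 h1
  have hTle : ∀ θ i, poissonLik θ (Y i) ≤ poissonLik (T θ) (Y i) := by
    intro θ i
    have h1 : poissonLik θ (Y i) ≤ poissonLik (c θ) (Y i) := poissonLik_le_inf θ (le_sampleMax Y i)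
    by_cases h : ∃ i, poissonLik (c θ) (Y i) ≠ 0
    · rw [hT]; simp only [if_pos h]; exact h1
    · push Not at h
      rw [h i] at h1
      exact h1.trans zero_le
  have hTlt : ∀ θ, (∃ k, (sampleMax Y k : ℝ≥0) < θ k) →
      ∃ i, poissonLik θ (Y i) < poissonLik (T θ) (Y i) := by
    rintro θ ⟨k, hk⟩
    by_cases h : ∃ i, poissonLik (c θ) (Y i) ≠ 0
    · obtain ⟨i, hi⟩ := h
      refine ⟨i, ?_⟩
      rw [hT]; simp only [if_pos (⟨i, hi⟩ : ∃ i, poissonLik (c θ) (Y i) ≠ 0)]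
      exact poissonLik_lt_inf (le_sampleMax Y i) hi hk
    · refine ⟨0, ?_⟩
      have h1 : poissonLik θ (Y 0) ≤ poissonLik (c θ) (Y 0) :=
        poissonLik_le_inf θ (le_sampleMax Y 0)
      rw [hT]; simp only [if_neg h]
      push Not at h
      rw [h 0] at h1
      exact h1.trans_lt (pos_iff_ne_zero.2 (hmaxpos 0))
  set Q' : Prior d := Q.map hTm.aemeasurable with hQ'
  have hmix' : ∀ y, mixture Q' y = ∫⁻ θ, poissonLik (T θ) y ∂(Q : Measure (Fin d → ℝ≥0)) := by
    intro y
    rw [mixture_apply, mixLik, hQ', ProbabilityMeasure.toMeasure_map,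
      lintegral_map (measurable_poissonLik y) hTm]
  have hmixle : ∀ i, mixture Q (Y i) ≤ mixture Q' (Y i) := by
    intro i
    rw [hmix']
    exact lintegral_mono fun θ => hTle θ i
  by_contra hcon
  have hstrict : ∃ i, mixture Q (Y i) < mixture Q' (Y i) := by
    by_contra hno
    push Not at hno
    have hae : ∀ i, ∀ᵐ θ ∂(Q : Measure (Fin d → ℝ≥0)),
        poissonLik θ (Y i) = poissonLik (T θ) (Y i) := by
      intro i
      refine ae_eq_of_ae_le_of_lintegral_le (Filter.Eventually.of_forall fun θ => hTle θ i)
        ((mixture Q).apply_ne_top (Y i)) ((measurable_poissonLik (Y i)).comp hTm).aemeasurable ?_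
      rw [← hmix']
      exact hno i
    refine hcon ((ae_all_iff.2 hae).mono fun θ hθ j => ?_)
    by_contra hj
    obtain ⟨i, hi⟩ := hTlt θ ⟨j, by exact_mod_cast not_le.1 hj⟩
    exact hi.ne (hθ i)
  obtain ⟨i, hi⟩ := hstrict
  have := hdec.lt_of_le_of_lt (q := mixture Q) (q' := mixture Q') hsupp (fun y hy => by
    obtain ⟨i, -, rfl⟩ := Finset.mem_image.1 hy
    exact hmixle i) ⟨Y i, Finset.mem_image_of_mem Y (Finset.mem_univ i), hi⟩ hfin
  exact (this.trans_le (hQ.2 Q' trivial)).false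

/-! ### Sampling bounds for the empirical distribution -/

theorem lintegral_pi_eval_eq_tsum {d n : ℕ} (p : PMF (Fin d → ℕ)) (g : (Fin d → ℕ) → ℝ≥0∞)
    (i : Fin n) : ∫⁻ Y, g (Y i) ∂(Measure.pi fun _ : Fin n => p.toMeasure) = ∑' y, g y * p y := by
  rw [(measurePreserving_eval (fun _ : Fin n => p.toMeasure) i).lintegral_comp
    (measurable_of_countable g), lintegral_countable']
  simp_rw [PMF.toMeasure_apply_singleton _ _ (measurableSet_singleton _)]

/-- The mean squared error of an empirical frequency: a binomial variance. -/
theorem lintegral_sq_empirical_sub_le {d n : ℕ} [NeZero n] (p : PMF (Fin d → ℕ)) (y : Fin d → ℕ) :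
    ∫⁻ Y, ENNReal.ofReal (((empirical Y y).toReal - (p y).toReal) ^ 2)
      ∂(Measure.pi fun _ : Fin n => p.toMeasure) ≤ p y / n := by
  classical
  set P := Measure.pi fun _ : Fin n => p.toMeasure with hP
  set X : (Fin d → ℕ) → ℝ := fun z => if z = y then 1 else 0 with hX
  have hXm : Measurable X := measurable_of_countable X
  have hXb : ∀ z, ‖X z‖ ≤ 1 := by
    intro z; rw [hX]; dsimp only; split_ifs <;> simp
  have hX2 : MemLp X 2 p.toMeasure :=
    MemLp.of_bound hXm.aestronglyMeasurable 1 (Filter.Eventually.of_forall hXb)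
  have hXint : ∫ z, X z ∂p.toMeasure = (p y).toReal := by
    have : X = Set.indicator {y} 1 := by
      ext z; by_cases h : z = y <;> simp [hX, h]
    rw [this, integral_indicator_one (measurableSet_singleton y), measureReal_def,
      PMF.toMeasure_apply_singleton _ _ (measurableSet_singleton _)]
  have hvarX : ProbabilityTheory.variance X p.toMeasure ≤ (p y).toReal := by
    refine (ProbabilityTheory.variance_le_expectation_sq hXm.aestronglyMeasurable).trans_eq ?_
    rw [← hXint]
    congr 1
    ext z
    by_cases h : z = y <;> simp [hX, h]
  set S : (Fin n → Fin d → ℕ) → ℝ := ∑ i, fun Y => X (Y i) with hS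
  have hSapp : ∀ Y, S Y = ∑ i, X (Y i) := fun Y => by rw [hS, Finset.sum_apply]
  have hmp := fun i => measurePreserving_eval (fun _ : Fin n => p.toMeasure) i
  have hSmean : ∫ Y, S Y ∂P = n * (p y).toReal := by
    simp_rw [hSapp]
    rw [integral_finsetSum _ fun i _ => show Integrable (fun Y => X (Y i)) P from
      ((hmp i).integrable_comp hXm.aestronglyMeasurable).2 (hX2.integrable (by norm_num))]
    have : ∀ i : Fin n, ∫ Y, X (Y i) ∂P = (p y).toReal := by
      intro i
      rw [← hXint, ← (hmp i).map_eq, integral_map (measurable_pi_apply i).aemeasurable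
        hXm.aestronglyMeasurable]
    simp [this]
  have hS2 : MemLp S 2 P :=
    memLp_finsetSum' _ fun i _ => hX2.comp_measurePreserving (hmp i)
  have hvarS : ProbabilityTheory.variance S P ≤ n * (p y).toReal := by
    rw [hS, hP, ProbabilityTheory.variance_sum_pi fun _ => hX2]
    simpa using mul_le_mul_of_nonneg_left hvarX (Nat.cast_nonneg n)
  have hev : ∫⁻ Y, ENNReal.ofReal ((S Y - n * (p y).toReal) ^ 2) ∂P ≤
      ENNReal.ofReal (n * (p y).toReal) := by
    rw [← hSmean, ← ProbabilityTheory.evariance_eq_lintegral_ofReal,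
      ← ProbabilityTheory.ofReal_variance hS2]
    exact ENNReal.ofReal_le_ofReal (by rw [hSmean]; exact hvarS)
  have hn : (0 : ℝ) < n := by exact_mod_cast Nat.pos_of_ne_zero (NeZero.ne n)
  have hpt : ∀ Y : Fin n → Fin d → ℕ,
      ENNReal.ofReal (((empirical Y y).toReal - (p y).toReal) ^ 2) =
        ENNReal.ofReal (((n : ℝ) ^ 2)⁻¹) * ENNReal.ofReal ((S Y - n * (p y).toReal) ^ 2) := by
    intro Y
    rw [← ENNReal.ofReal_mul (by positivity), empirical_apply_toReal, hSapp]
    congr 1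
    field_simp
    rfl
  simp_rw [hpt]
  rw [lintegral_const_mul _ (measurable_of_countable _)]
  calc _ ≤ ENNReal.ofReal (((n : ℝ) ^ 2)⁻¹) * ENNReal.ofReal (n * (p y).toReal) := by gcongr
    _ = ENNReal.ofReal ((p y).toReal / n) := by
        rw [← ENNReal.ofReal_mul (by positivity)]
        congr 1
        field_simp
    _ = p y / n := by
        rw [ENNReal.ofReal_div_of_pos hn, ENNReal.ofReal_toReal (p.apply_ne_top y),
          ENNReal.ofReal_natCast]

/-- The mass which `p` gives to the points whose coordinate `j` is at least `K`. -/
noncomputable def coordTail {d : ℕ} (p : (Fin d → ℕ) → ℝ≥0∞) (K : ℕ) (j : Fin d) : ℝ≥0∞ :=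
  ∑' y, {y : Fin d → ℕ | K ≤ y j}.indicator p y

theorem tsum_indicator_exists_le {d : ℕ} (p : (Fin d → ℕ) → ℝ≥0∞) (K : ℕ) :
    ∑' y, {y : Fin d → ℕ | ∃ j, K ≤ y j}.indicator p y ≤ ∑ j, coordTail p K j := by
  unfold coordTail
  rw [← Summable.tsum_finsetSum fun _ _ => ENNReal.summable]
  refine ENNReal.tsum_le_tsum fun y => ?_
  by_cases h : ∃ j, K ≤ y j
  · obtain ⟨j, hj⟩ := h
    rw [Set.indicator_of_mem (show y ∈ {y : Fin d → ℕ | ∃ j, K ≤ y j} from ⟨j, hj⟩)]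
    refine le_trans ?_ (Finset.single_le_sum (fun _ _ => zero_le) (Finset.mem_univ j))
    rw [Set.indicator_of_mem (by exact hj)]
  · rw [Set.indicator_of_notMem (by exact h)]
    exact zero_le

/-- If all observations are below `K`, only the cells of the box `[0, K)^d` contribute empirical
frequencies to the `χ²`-divergence, and the other cells contribute their model probability. -/
theorem chiSq_empirical_le {d n : ℕ} [NeZero n] (p : PMF (Fin d → ℕ)) {K : ℕ}
    {Y : Fin n → Fin d → ℕ} (hY : ∀ i j, Y i j < K) :
    chiSq (empirical Y) p ≤
      ∑ y ∈ Fintype.piFinset fun _ : Fin d => Finset.range K,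
        ENNReal.ofReal (((empirical Y y).toReal - (p y).toReal) ^ 2) / p y +
      ∑ j, coordTail p K j := by
  classical
  refine le_trans ?_ (add_le_add_right (tsum_indicator_exists_le p K) _)
  set s := Fintype.piFinset fun _ : Fin d => Finset.range K with hs
  rw [sum_eq_tsum_indicator,
    ← ENNReal.tsum_add]
  refine ENNReal.tsum_le_tsum fun y => ?_
  by_cases hy : ∃ j, K ≤ y j
  · refine le_trans ?_ le_add_self
    rw [Set.indicator_of_mem (by exact hy)]
    have h0 : empirical Y y = 0 := by
      by_contra h
      obtain ⟨i, rfl⟩ := (empirical_ne_zero_iff Y y).1 h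
      obtain ⟨j, hj⟩ := hy
      exact (hY i j).not_ge hj
    rw [h0, ENNReal.toReal_zero, zero_sub, neg_sq, ENNReal.ofReal_pow ENNReal.toReal_nonneg,
      ENNReal.ofReal_toReal (p.apply_ne_top y), sq]
    refine ENNReal.div_le_of_le_mul le_rfl
  · refine le_trans ?_ le_self_add
    push Not at hy
    rw [Set.indicator_of_mem (by simpa [hs] using hy)]

theorem lintegral_indicator_chiSq_empirical_le {d n : ℕ} [NeZero n] (p : PMF (Fin d → ℕ))
    (K : ℕ) :
    ∫⁻ Y, {Y : Fin n → Fin d → ℕ | ∀ i j, Y i j < K}.indicator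
        (fun Y => chiSq (empirical Y) p) Y ∂(Measure.pi fun _ : Fin n => p.toMeasure) ≤
      (K : ℝ≥0∞) ^ d / n + ∑ j, coordTail p K j := by
  calc _ ≤ ∫⁻ Y, (∑ y ∈ Fintype.piFinset fun _ : Fin d => Finset.range K,
        ENNReal.ofReal (((empirical Y y).toReal - (p y).toReal) ^ 2) / p y +
      ∑ j, coordTail p K j) ∂(Measure.pi fun _ : Fin n => p.toMeasure) := by
        refine lintegral_mono fun Y => ?_
        exact Set.indicator_apply_le' (fun hY => chiSq_empirical_le p hY) fun _ => zero_le
    _ ≤ ∑ y ∈ Fintype.piFinset fun _ : Fin d => Finset.range K, (n : ℝ≥0∞)⁻¹ +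
          ∑ j, coordTail p K j := by
        rw [lintegral_add_right _ measurable_const, lintegral_const, measure_univ, mul_one,
          lintegral_finsetSum _ fun y _ => measurable_of_countable _]
        gcongr with y
        simp_rw [div_eq_mul_inv]
        rw [lintegral_mul_const _ (measurable_of_countable _), ← div_eq_mul_inv]
        refine ENNReal.div_le_of_le_mul ?_
        rw [mul_comm, ← div_eq_mul_inv]
        exact lintegral_sq_empirical_sub_le p y
    _ = _ := by
        rw [Finset.sum_const, Fintype.card_piFinset_const, Finset.card_range, nsmul_eq_mul,
          div_eq_mul_inv]
        push_cast
        simp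

theorem measure_compl_forall_lt_le {d n : ℕ} (p : PMF (Fin d → ℕ)) (K : ℕ) :
    (Measure.pi fun _ : Fin n => p.toMeasure) {Y | ∀ i j, Y i j < K}ᶜ ≤
      n * ∑ j, coordTail p K j := by
  have hsub : {Y : Fin n → Fin d → ℕ | ∀ i j, Y i j < K}ᶜ =
      ⋃ i, {Y : Fin n → Fin d → ℕ | ∃ j, K ≤ Y i j} := by
    ext Y; simp
  rw [hsub]
  refine (measure_iUnion_le _).trans ?_
  rw [tsum_fintype]
  have h : ∀ i : Fin n, (Measure.pi fun _ : Fin n => p.toMeasure)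
      {Y : Fin n → Fin d → ℕ | ∃ j, K ≤ Y i j} ≤ ∑ j, coordTail p K j := by
    intro i
    refine le_trans ?_ (tsum_indicator_exists_le p K)
    rw [← lintegral_indicator_one (Set.to_countable _).measurableSet]
    refine (lintegral_pi_eval_eq_tsum p
      (fun y => {y : Fin d → ℕ | ∃ j, K ≤ y j}.indicator 1 y) i).le.trans ?_
    refine ENNReal.tsum_le_tsum fun y => ?_
    by_cases hy : ∃ j, K ≤ y j
    · rw [Set.indicator_of_mem (by exact hy), Set.indicator_of_mem (by exact hy)]; simp
    · rw [Set.indicator_of_notMem (by exact hy)]; simp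
  refine (Finset.sum_le_sum fun i _ => h i).trans ?_
  simp

/-- Chernoff's bound for a coordinate of a Poisson mixture. -/
theorem pow_mul_coordTail_le {d : ℕ} (μ : Measure (Fin d → ℝ≥0)) (K : ℕ) (j : Fin d) {z : ℝ≥0}
    (hz : 1 ≤ z) : (z : ℝ≥0∞) ^ K * coordTail (mixLik μ) K j ≤
      ∫⁻ θ, ENNReal.ofReal (Real.exp ((θ j : ℝ) * (z - 1))) ∂μ := by
  rw [← tsum_pow_mul_mixLik, coordTail, ← ENNReal.tsum_mul_left]
  refine ENNReal.tsum_le_tsum fun y => ?_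
  by_cases hy : K ≤ y j
  · rw [Set.indicator_of_mem (by exact hy)]
    gcongr
    exact_mod_cast hz
  · rw [Set.indicator_of_notMem (by exact hy)]
    simp

/-! ### The regret of a minimum-distance estimate -/

/-- The estimated mixture is as close in Hellinger distance to the true one as the empirical
distribution is in `χ²`-divergence: both are compared with the empirical distribution. -/
theorem hellSq_mixture_le_chiSq {d : ℕ} {a b : ℝ} (ha : 0 < a)
    {dist : PMF (Fin d → ℕ) → PMF (Fin d → ℕ) → ℝ≥0∞} (hsand : IsSandwiched a b dist)
    {p f q : PMF (Fin d → ℕ)} (hmin : dist p q ≤ dist p f) :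
    hellSq f q ≤ ENNReal.ofReal (4 * (b / a)) * chiSq p f := by
  have ha' : ENNReal.ofReal a ≠ 0 := by simpa using ha
  have hle : ∀ r : PMF (Fin d → ℕ), dist p r ≤ dist p f →
      hellSq p r ≤ ENNReal.ofReal (b / a) * chiSq p f := by
    intro r hr
    have h1 : ENNReal.ofReal a * hellSq p r ≤ ENNReal.ofReal b * chiSq p f :=
      (hsand p r).1.trans (hr.trans (hsand p f).2)
    rw [ENNReal.ofReal_div_of_pos ha, ← ENNReal.mul_div_right_comm,
      ENNReal.le_div_iff_mul_le (Or.inl ha') (Or.inl ENNReal.ofReal_ne_top), mul_comm]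
    exact h1
  have h1 := hellSq_triangle (f : (Fin d → ℕ) → ℝ≥0∞) p q
  have h2 := hle f le_rfl
  have h3 := hle q hmin
  rw [hellSq_comm] at h2
  calc hellSq f q ≤ 2 * (ENNReal.ofReal (b / a) * chiSq p f) +
        2 * (ENNReal.ofReal (b / a) * chiSq p f) := by
        refine h1.trans ?_
        gcongr
    _ = _ := by
        rw [ENNReal.ofReal_mul (by norm_num), show ENNReal.ofReal 4 = 4 by simp]
        ring

theorem regret_eq_sum {d n : ℕ} (Ghat : (Fin n → Fin d → ℕ) → Prior d) (G : Prior d) :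
    regret Ghat G = ∑ j, ∫⁻ Y, ∑' y,
      ENNReal.ofReal ((postMean (Ghat Y : Measure (Fin d → ℝ≥0)) y j -
        postMean (G : Measure (Fin d → ℝ≥0)) y j) ^ 2) * mixLik (G : Measure (Fin d → ℝ≥0)) y
      ∂(Measure.pi fun _ : Fin n => (mixture G).toMeasure) := by
  rw [← lintegral_finsetSum _ fun j _ => measurable_of_countable _, regret]
  refine lintegral_congr fun Y => ?_
  rw [← Summable.tsum_finsetSum fun _ _ => ENNReal.summable]
  refine tsum_congr fun y => ?_
  rw [← Finset.sum_mul, ENNReal.ofReal_sum_of_nonneg fun _ _ => sq_nonneg _, mixture_apply]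
  simp_rw [bayesEst_eq_postMean]

/-- Regret bound by the variance of the empirical distribution in the box `[0, K)^d`, the tails of
the mixture, and the part of the prior outside the box `[0, h]^d`. Here `V` bounds the support of
the estimated prior on the rare samples which leave the box. -/
theorem regret_le_sum {d n : ℕ} [NeZero n] {a b : ℝ} (ha : 0 < a)
    {dist : PMF (Fin d → ℕ) → PMF (Fin d → ℕ) → ℝ≥0∞} (hsand : IsSandwiched a b dist)
    {G : Prior d} {Ghat : (Fin n → Fin d → ℕ) → Prior d}
    (hmin : ∀ Y, dist (empirical Y) (mixture (Ghat Y)) ≤ dist (empirical Y) (mixture G))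
    {h : ℝ} (h0 : 0 ≤ h) {K : ℕ}
    (hbox : ∀ Y, (∀ i j, Y i j < K) →
      ∀ᵐ θ ∂(Ghat Y : Measure (Fin d → ℝ≥0)), ∀ j, (θ j : ℝ) ≤ h)
    {V : (Fin n → Fin d → ℕ) → Fin d → ℝ} (hV0 : ∀ Y j, 0 ≤ V Y j)
    (hV : ∀ Y, ∀ᵐ θ ∂(Ghat Y : Measure (Fin d → ℝ≥0)), ∀ j, (θ j : ℝ) ≤ V Y j)
    {ρ : Measure (Fin d → ℝ≥0)}
    (hρ : ρ = (G : Measure (Fin d → ℝ≥0)).restrict {θ | ∀ j, (θ j : ℝ) ≤ h}ᶜ) :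
    regret Ghat G ≤ ∑ j, (ENNReal.ofReal (64 * h ^ 2 + 64 * h * K) *
          (ENNReal.ofReal (4 * (b / a)) *
            ((K : ℝ≥0∞) ^ d / n + ∑ k, coordTail (mixture G) K k) + ρ Set.univ) +
        2 * ENNReal.ofReal (h ^ 2) * coordTail (mixture G) K j +
        4 * ENNReal.ofReal (h ^ 2) * ρ Set.univ + 2 * ∫⁻ θ, (θ j : ℝ≥0∞) ^ 2 ∂ρ +
        2 * ∫⁻ Y in {Y : Fin n → Fin d → ℕ | ∀ i j, Y i j < K}ᶜ,
          ENNReal.ofReal (V Y j ^ 2 + h ^ 2)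
            ∂(Measure.pi fun _ : Fin n => (mixture G).toMeasure)) := by
  rw [regret_eq_sum]
  refine Finset.sum_le_sum fun j _ => ?_
  set A : Set (Fin n → Fin d → ℕ) := {Y | ∀ i j, Y i j < K} with hA
  set P := Measure.pi fun _ : Fin n => (mixture G).toMeasure with hP
  have hBm : MeasurableSet {θ : Fin d → ℝ≥0 | ∀ j, (θ j : ℝ) ≤ h} := by
    measurability
  set μ := (G : Measure (Fin d → ℝ≥0)).restrict {θ | ∀ j, (θ j : ℝ) ≤ h} with hμdef
  have hG : (G : Measure (Fin d → ℝ≥0)) = μ + ρ := by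
    rw [hρ, hμdef, Measure.restrict_add_restrict_compl hBm]
  have : IsFiniteMeasure ρ := by rw [hρ]; infer_instance
  have : IsProbabilityMeasure (μ + ρ) := by rw [← hG]; infer_instance
  have hμ : ∀ᵐ θ ∂μ, (θ j : ℝ) ≤ h := (ae_restrict_mem hBm).mono fun θ hθ => hθ j
  have hT : coordTail (mixture G) K j =
      ∑' y, {y : Fin d → ℕ | K ≤ y j}.indicator (mixLik (μ + ρ)) y := by
    rw [← hG]; rfl
  set c := ENNReal.ofReal (64 * h ^ 2 + 64 * h * K) with hc
  set τ := ∫⁻ θ, (θ j : ℝ≥0∞) ^ 2 ∂ρ with hτ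
  set C : ℝ≥0∞ := c * ρ Set.univ + 2 * ENNReal.ofReal (h ^ 2) * coordTail (mixture G) K j +
      4 * ENNReal.ofReal (h ^ 2) * ρ Set.univ + 2 * τ with hC
  have hpt : ∀ Y, ∑' y, ENNReal.ofReal ((postMean (Ghat Y : Measure (Fin d → ℝ≥0)) y j -
        postMean (G : Measure (Fin d → ℝ≥0)) y j) ^ 2) * mixLik (G : Measure (Fin d → ℝ≥0)) y ≤
      C + c * (ENNReal.ofReal (4 * (b / a)) *
          A.indicator (fun Y => chiSq (empirical Y) (mixture G)) Y) +
        2 * Aᶜ.indicator (fun Y => ENNReal.ofReal (V Y j ^ 2 + h ^ 2)) Y := by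
    intro Y
    by_cases hY : Y ∈ A
    · rw [Set.indicator_of_mem hY, Set.indicator_of_notMem (Set.notMem_compl_iff.2 hY), mul_zero,
        add_zero]
      have h1 := hellSq_mixture_le_chiSq ha hsand (hmin Y)
      have h2 := tsum_sq_postMean_sub_le_hellSq (μ := μ) (ρ := ρ)
        (ν := (Ghat Y : Measure (Fin d → ℝ≥0))) h0 hμ ((hbox Y hY).mono fun θ hθ => hθ j) K
      rw [← hT, ← hG] at h2
      have h3 : hellSq (mixLik (G : Measure (Fin d → ℝ≥0)))
          (mixLik (Ghat Y : Measure (Fin d → ℝ≥0))) ≤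
          ENNReal.ofReal (4 * (b / a)) * chiSq (empirical Y) (mixture G) := h1
      refine h2.trans ?_
      calc _ ≤ c * (ENNReal.ofReal (4 * (b / a)) * chiSq (empirical Y) (mixture G) +
              ρ Set.univ) +
            2 * ENNReal.ofReal (h ^ 2) * coordTail (mixture G) K j +
            4 * ENNReal.ofReal (h ^ 2) * ρ Set.univ + 2 * τ := by gcongr
        _ = _ := by rw [hC]; ring
    · rw [Set.indicator_of_notMem hY, Set.indicator_of_mem (Set.mem_compl hY), mul_zero, mul_zero,
        add_zero]
      have h2 := tsum_sq_postMean_sub_le_sq_add_sq (μ := μ) (ρ := ρ)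
        (ν := (Ghat Y : Measure (Fin d → ℝ≥0))) h0 (hV0 Y j) hμ ((hV Y).mono fun θ hθ => hθ j)
      rw [← hG] at h2
      refine h2.trans ?_
      rw [add_comm]
      gcongr
      calc 2 * (τ + ENNReal.ofReal (h ^ 2) * ρ Set.univ)
          ≤ 4 * ENNReal.ofReal (h ^ 2) * ρ Set.univ + 2 * τ := by
            rw [mul_add, add_comm, ← mul_assoc]
            gcongr ?_ * _ * _ + _
            exact (by norm_num : (2 : ℝ≥0∞) ≤ 4)
        _ ≤ C := by
            rw [hC, add_assoc (c * ρ Set.univ + _)]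
            exact le_add_self
  refine (lintegral_mono hpt).trans ?_
  rw [lintegral_add_right _ (measurable_of_countable _),
    lintegral_add_right _ (measurable_of_countable _), lintegral_const, measure_univ, mul_one,
    lintegral_const_mul _ (measurable_of_countable _),
    lintegral_const_mul _ (measurable_of_countable _),
    lintegral_const_mul _ (measurable_of_countable _),
    lintegral_indicator (Set.to_countable Aᶜ).measurableSet]
  calc _ ≤ C + c * (ENNReal.ofReal (4 * (b / a)) *
          ((K : ℝ≥0∞) ^ d / n + ∑ k, coordTail (mixture G) K k)) +
        2 * ∫⁻ Y in Aᶜ, ENNReal.ofReal (V Y j ^ 2 + h ^ 2) ∂P := by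
        gcongr
        exact lintegral_indicator_chiSq_empirical_le (mixture G) K
    _ = _ := by rw [hC]; ring

/-- The bound of `regret_le_sum` in real numbers. -/
theorem regret_le_ofReal {d n : ℕ} [NeZero n] {a b : ℝ} (ha : 0 < a) (hb : 0 < b)
    {dist : PMF (Fin d → ℕ) → PMF (Fin d → ℕ) → ℝ≥0∞} (hsand : IsSandwiched a b dist)
    {G : Prior d} {Ghat : (Fin n → Fin d → ℕ) → Prior d}
    (hmin : ∀ Y, dist (empirical Y) (mixture (Ghat Y)) ≤ dist (empirical Y) (mixture G))
    {h : ℝ} (h0 : 0 ≤ h) {K : ℕ}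
    (hbox : ∀ Y, (∀ i j, Y i j < K) →
      ∀ᵐ θ ∂(Ghat Y : Measure (Fin d → ℝ≥0)), ∀ j, (θ j : ℝ) ≤ h)
    {V : (Fin n → Fin d → ℕ) → Fin d → ℝ} (hV0 : ∀ Y j, 0 ≤ V Y j)
    (hV : ∀ Y, ∀ᵐ θ ∂(Ghat Y : Measure (Fin d → ℝ≥0)), ∀ j, (θ j : ℝ) ≤ V Y j)
    {ε δ τ w : ℝ} (hε0 : 0 ≤ ε) (hδ0 : 0 ≤ δ) (hτ0 : 0 ≤ τ) (hw0 : 0 ≤ w)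
    (hε : ∀ j, coordTail (mixture G) K j ≤ ENNReal.ofReal ε)
    (hδ : (G : Measure (Fin d → ℝ≥0)) {θ | ∀ j, (θ j : ℝ) ≤ h}ᶜ ≤ ENNReal.ofReal δ)
    (hτ : ∀ j, ∫⁻ θ in {θ | ∀ j, (θ j : ℝ) ≤ h}ᶜ, (θ j : ℝ≥0∞) ^ 2
      ∂(G : Measure (Fin d → ℝ≥0)) ≤ ENNReal.ofReal τ)
    (hw : ∀ j, ∫⁻ Y in {Y : Fin n → Fin d → ℕ | ∀ i j, Y i j < K}ᶜ, ENNReal.ofReal (V Y j ^ 2)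
      ∂(Measure.pi fun _ : Fin n => (mixture G).toMeasure) ≤ ENNReal.ofReal w) :
    regret Ghat G ≤ ENNReal.ofReal (d * ((64 * h ^ 2 + 64 * h * K) *
        (4 * (b / a) * ((K : ℝ) ^ d / n + d * ε) + δ) + 2 * h ^ 2 * ε + 4 * h ^ 2 * δ + 2 * τ +
        2 * (w + h ^ 2 * (n * (d * ε))))) := by
  refine (regret_le_sum ha hsand hmin h0 hbox hV0 hV rfl).trans ?_
  have hn : (0 : ℝ) < n := by exact_mod_cast Nat.pos_of_ne_zero (NeZero.ne n)
  have hba : 0 < b / a := div_pos hb ha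
  have hsum : ∑ k, coordTail (mixture G) K k ≤ ENNReal.ofReal (d * ε) := by
    refine (Finset.sum_le_sum fun k _ => hε k).trans_eq ?_
    rw [ENNReal.ofReal_mul (by positivity)]
    simp
  have hKn : (K : ℝ≥0∞) ^ d / n = ENNReal.ofReal ((K : ℝ) ^ d / n) := by
    rw [ENNReal.ofReal_div_of_pos hn, ENNReal.ofReal_pow (by positivity), ENNReal.ofReal_natCast,
      ENNReal.ofReal_natCast]
  have hVint : ∀ j, ∫⁻ Y in {Y : Fin n → Fin d → ℕ | ∀ i j, Y i j < K}ᶜ,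
      ENNReal.ofReal (V Y j ^ 2 + h ^ 2)
        ∂(Measure.pi fun _ : Fin n => (mixture G).toMeasure) ≤
      ENNReal.ofReal (w + h ^ 2 * (n * (d * ε))) := by
    intro j
    simp_rw [fun Y => ENNReal.ofReal_add (sq_nonneg (V Y j)) (sq_nonneg h)]
    rw [lintegral_add_right _ measurable_const, lintegral_const, Measure.restrict_apply_univ,
      ENNReal.ofReal_add hw0 (by positivity), ENNReal.ofReal_mul (by positivity)]
    gcongr
    · exact hw j
    · refine (measure_compl_forall_lt_le (mixture G) K).trans ?_
      rw [ENNReal.ofReal_mul (by positivity), ENNReal.ofReal_natCast]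
      gcongr
  have e2 : (2 : ℝ≥0∞) = ENNReal.ofReal 2 := by simp
  have e4 : (4 : ℝ≥0∞) = ENNReal.ofReal 4 := by simp
  calc _ ≤ ∑ _j : Fin d, (ENNReal.ofReal (64 * h ^ 2 + 64 * h * K) *
          (ENNReal.ofReal (4 * (b / a)) *
            (ENNReal.ofReal ((K : ℝ) ^ d / n) + ENNReal.ofReal (d * ε)) + ENNReal.ofReal δ) +
        ENNReal.ofReal 2 * ENNReal.ofReal (h ^ 2) * ENNReal.ofReal ε +
        ENNReal.ofReal 4 * ENNReal.ofReal (h ^ 2) * ENNReal.ofReal δ +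
        ENNReal.ofReal 2 * ENNReal.ofReal τ +
        ENNReal.ofReal 2 * ENNReal.ofReal (w + h ^ 2 * (n * (d * ε)))) := by
        rw [← hKn, ← e2, ← e4]
        gcongr with j
        · rw [Measure.restrict_apply_univ]; exact hδ
        · exact hε j
        · rw [Measure.restrict_apply_univ]; exact hδ
        · exact hτ j
        · exact hVint j
    _ = _ := by
        rw [Finset.sum_const, Finset.card_univ, Fintype.card_fin, nsmul_eq_mul,
          ← ENNReal.ofReal_natCast]
        rw [← ENNReal.ofReal_add (by positivity) (by positivity),
          ← ENNReal.ofReal_mul (by positivity),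
          ← ENNReal.ofReal_add (by positivity) (by positivity),
          ← ENNReal.ofReal_mul (by positivity), ← ENNReal.ofReal_mul (by positivity),
          ← ENNReal.ofReal_mul (by positivity), ← ENNReal.ofReal_mul (by positivity),
          ← ENNReal.ofReal_mul (by positivity), ← ENNReal.ofReal_mul (by positivity),
          ← ENNReal.ofReal_mul (by positivity),
          ← ENNReal.ofReal_add (by positivity) (by positivity),
          ← ENNReal.ofReal_add (by positivity) (by positivity),
          ← ENNReal.ofReal_add (by positivity) (by positivity),
          ← ENNReal.ofReal_add (by positivity) (by positivity),
          ← ENNReal.ofReal_mul (by positivity)]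

/-! ### Priors supported on a box -/

theorem mem_boxPriors_iff_ae {d : ℕ} {h : ℝ} {G : Prior d} :
    G ∈ boxPriors d h ↔ ∀ᵐ θ ∂(G : Measure (Fin d → ℝ≥0)), ∀ j, (θ j : ℝ) ≤ h := by
  have hBm : MeasurableSet {θ : Fin d → ℝ≥0 | ∀ j, (θ j : ℝ) ≤ h} := by
    measurability
  exact (mem_ae_iff_prob_eq_one hBm).symm

/-- With `x = log n`, this is `log n / 2 ≤ L log L` for `L = log n / log log n`. -/
theorem half_log_le_div_mul_log {x : ℝ} (hx : 1 < x) :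
    x / 2 ≤ x / Real.log x * Real.log (x / Real.log x) := by
  have hy : 0 < Real.log x := Real.log_pos hx
  have h1 : Real.log (Real.log x) ≤ Real.log x / 2 := by
    have h2 := Real.log_le_sub_one_of_pos (half_pos hy)
    rw [Real.log_div hy.ne' two_ne_zero] at h2
    linarith [Real.log_two_lt_d9]
  rw [Real.log_div (by positivity) hy.ne']
  calc x / 2 = x / Real.log x * (Real.log x / 2) := by field_simp
    _ ≤ _ := by gcongr; linarith

/-- Chernoff's bound for a prior on the box `[0, h]^d`; `z = K / h` is the optimal choice. -/
theorem coordTail_le_of_box {d : ℕ} {G : Prior d} {h : ℝ}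
    (hG : ∀ᵐ θ ∂(G : Measure (Fin d → ℝ≥0)), ∀ j, (θ j : ℝ) ≤ h) (j : Fin d) {K : ℕ} {z : ℝ≥0}
    (hz : 1 ≤ z) :
    coordTail (mixture G) K j ≤ ENNReal.ofReal (Real.exp (h * (z - 1)) / (z : ℝ) ^ K) := by
  have h1 := pow_mul_coordTail_le (G : Measure (Fin d → ℝ≥0)) K j hz
  have h2 : ∫⁻ θ, ENNReal.ofReal (Real.exp ((θ j : ℝ) * (z - 1))) ∂(G : Measure (Fin d → ℝ≥0)) ≤
      ENNReal.ofReal (Real.exp (h * (z - 1))) := by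
    refine (lintegral_mono_ae (g := fun _ => ENNReal.ofReal (Real.exp (h * (z - 1))))
      (hG.mono fun θ hθ => ?_)).trans_eq (by simp)
    have : (0 : ℝ) ≤ z - 1 := sub_nonneg.2 (by exact_mod_cast hz)
    gcongr
    exact hθ j
  have hz0 : 0 < (z : ℝ) := by
    have : (1 : ℝ) ≤ z := by exact_mod_cast hz
    linarith
  rw [ENNReal.ofReal_div_of_pos (by positivity),
    ENNReal.le_div_iff_mul_le (Or.inl (ENNReal.ofReal_pos.2 (by positivity)).ne')
      (Or.inl ENNReal.ofReal_ne_top), mul_comm, ENNReal.ofReal_pow hz0.le, ENNReal.ofReal_coe_nnreal]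
  exact h1.trans h2

/-- The Poisson tail at the level `K ≈ 6 h log n / log log n` is at most `n⁻³`. -/
theorem coordTail_le_inv_pow_three {d n : ℕ} {G : Prior d} {h : ℝ} (h1 : 1 ≤ h)
    (hG : ∀ᵐ θ ∂(G : Measure (Fin d → ℝ≥0)), ∀ j, (θ j : ℝ) ≤ h) (j : Fin d)
    (hn : 1 < Real.log n) {K : ℕ}
    (hK : 6 * h * (Real.log n / Real.log (Real.log n)) ≤ K) :
    coordTail (mixture G) K j ≤ ENNReal.ofReal (((n : ℝ) ^ 3)⁻¹) := by
  have hn0 : (0 : ℝ) < n := by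
    rcases Nat.eq_zero_or_pos n with rfl | h'
    · simp at hn; linarith
    · exact_mod_cast h'
  have hL := half_log_le_div_mul_log hn
  set x := Real.log n with hx
  have hy : 0 < Real.log x := Real.log_pos hn
  set L := x / Real.log x with hLdef
  have hL1 : 1 ≤ L := by
    rw [hLdef, one_le_div hy]
    linarith [Real.log_le_sub_one_of_pos (by linarith : 0 < x)]
  have hh0 : 0 < h := by linarith
  have hzval : 6 * L ≤ K / h := by
    rw [le_div_iff₀ hh0]; linarith
  set z : ℝ≥0 := ⟨K / h, by positivity⟩ with hz
  have hzr : (z : ℝ) = K / h := rfl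
  have hz1 : 1 ≤ z := by
    rw [← NNReal.coe_le_coe, hzr]; push_cast; linarith
  have hz0 : (0 : ℝ) < K / h := by linarith
  refine (coordTail_le_of_box hG j (K := K) hz1).trans (ENNReal.ofReal_le_ofReal ?_)
  rw [hzr]
  have hlogz : 1 + Real.log L ≤ Real.log (K / h) := by
    have h6 : 1 ≤ Real.log 6 := by
      rw [Real.le_log_iff_exp_le (by norm_num)]
      linarith [Real.exp_one_lt_d9]
    calc 1 + Real.log L ≤ Real.log 6 + Real.log L := by linarith
      _ = Real.log (6 * L) := (Real.log_mul (by norm_num) (by positivity)).symm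
      _ ≤ _ := Real.log_le_log (by positivity) hzval
  have hlogL : 0 ≤ Real.log L := Real.log_nonneg hL1
  have e1 : ((K : ℝ) / h) ^ K = Real.exp (K * Real.log (K / h)) := by
    rw [Real.exp_nat_mul, Real.exp_log hz0]
  have e2 : ((n : ℝ) ^ 3)⁻¹ = Real.exp (-(3 * x)) := by
    rw [Real.exp_neg, hx, show (3 : ℝ) * Real.log n = ((3 : ℕ) : ℝ) * Real.log n by norm_num,
      Real.exp_nat_mul, Real.exp_log hn0]
  rw [e1, e2, ← Real.exp_sub]
  refine Real.exp_le_exp.2 ?_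
  have e3 : h * (K / h - 1) = K - h := by field_simp
  rw [e3]
  have e4 : (K : ℝ) * (1 + Real.log L) ≤ K * Real.log (K / h) := by gcongr
  have e5 : 6 * h * L * Real.log L ≤ K * Real.log L := by gcongr
  have e6 : 6 * (L * Real.log L) ≤ 6 * h * L * Real.log L := by
    have : 0 ≤ L * Real.log L := by positivity
    nlinarith
  nlinarith

theorem one_lt_log_of_three_le {n : ℕ} (hn : 3 ≤ n) : 1 < Real.log n := by
  rw [Real.lt_log_iff_exp_lt (by positivity)]
  have : (3 : ℝ) ≤ n := by exact_mod_cast hn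
  linarith [Real.exp_one_lt_d9]

/-- Here `K` is about `6 h log n / log log n`, so that `h K * K ^ d / n` is of the claimed order; all
other terms carry a factor `n⁻³`. -/
theorem regret_le_of_box {a b : ℝ} (ha : 0 < a) (hb : 0 < b) {d n : ℕ} [NeZero n] (hd : d ≤ n)
    {dist : PMF (Fin d → ℕ) → PMF (Fin d → ℕ) → ℝ≥0∞} (hsand : IsSandwiched a b dist)
    {Ghat : (Fin n → Fin d → ℕ) → Prior d} {h : ℝ} (hn : 3 ≤ n)
    (hmin : ∀ Y, IsMinDist dist (boxPriors d h) (empirical Y) (Ghat Y))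
    {G : Prior d} (hG : G ∈ boxPriors d h) :
    regret Ghat G ≤ ENNReal.ofReal
      ((d : ℝ) * (7 * (1024 * (b / a) + 6) * max 1 h) ^ (d + 2) / (n : ℝ) *
        (Real.log n / Real.log (Real.log n)) ^ (d + 1)) := by
  have hx := one_lt_log_of_three_le hn
  set H := max 1 h with hH
  have hH1 : 1 ≤ H := le_max_left _ _
  have hbox : ∀ Q ∈ boxPriors d h,
      ∀ᵐ θ ∂(Q : Measure (Fin d → ℝ≥0)), ∀ j, (θ j : ℝ) ≤ H := fun Q hQ =>
    (mem_boxPriors_iff_ae.1 hQ).mono fun θ hθ j => (hθ j).trans (le_max_right _ _)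
  have hy : 0 < Real.log (Real.log n) := Real.log_pos hx
  set L := Real.log n / Real.log (Real.log n) with hL
  have hL1 : 1 ≤ L := by
    rw [hL, one_le_div hy]
    linarith [Real.log_le_sub_one_of_pos (by linarith : 0 < Real.log n)]
  have hHL : 1 ≤ H * L := one_le_mul_of_one_le_of_one_le hH1 hL1
  set K := ⌈6 * H * L⌉₊ with hK
  have hKge : 6 * H * L ≤ K := Nat.le_ceil _
  have hKle : (K : ℝ) ≤ 7 * H * L := by
    have := Nat.ceil_lt_add_one (by positivity : 0 ≤ 6 * H * L)
    linarith
  have hHK : H ≤ K := by nlinarith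
  have hn0 : (0 : ℝ) < n := by exact_mod_cast Nat.pos_of_ne_zero (NeZero.ne n)
  have hn1 : (1 : ℝ) ≤ n := by exact_mod_cast Nat.pos_of_ne_zero (NeZero.ne n)
  have hdn : (d : ℝ) ≤ n := by exact_mod_cast hd
  set ε : ℝ := ((n : ℝ) ^ 3)⁻¹ with hε
  have hε0 : 0 ≤ ε := by positivity
  have hT : ∀ j, coordTail (mixture G) K j ≤ ENNReal.ofReal ε := fun j =>
    coordTail_le_inv_pow_three hH1 (hbox G hG) j hx hKge
  have hnull : (G : Measure (Fin d → ℝ≥0)) {θ | ∀ j, (θ j : ℝ) ≤ H}ᶜ = 0 := hbox G hG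
  have hmain := regret_le_ofReal (V := fun _ _ => H) (K := K) (h := H) (δ := 0) (τ := 0)
    (w := H ^ 2 * (n * (d * ε))) ha hb hsand (fun Y => (hmin Y).2 G hG) (by positivity)
    (fun Y _ => hbox _ (hmin Y).1) (fun _ _ => by positivity) (fun Y => hbox _ (hmin Y).1)
    hε0 le_rfl le_rfl (by positivity) hT (by rw [hnull]; exact zero_le)
    (fun j => by rw [Measure.restrict_eq_zero.2 hnull]; simp) (fun j => by
      rw [lintegral_const, Measure.restrict_apply_univ, ENNReal.ofReal_mul (by positivity)]
      gcongr
      refine (measure_compl_forall_lt_le (mixture G) K).trans ?_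
      rw [ENNReal.ofReal_mul (by positivity), ENNReal.ofReal_natCast]
      gcongr
      refine (Finset.sum_le_sum fun k _ => hT k).trans_eq ?_
      rw [ENNReal.ofReal_mul (by positivity)]
      simp)
  refine hmain.trans (ENNReal.ofReal_le_ofReal ?_)
  have hnde : n * (d * ε) ≤ 1 / n := by
    calc (n : ℝ) * (d * ε) ≤ n * (n * ε) := by gcongr
      _ = 1 / n := by rw [hε]; field_simp
  have hde : d * ε ≤ 1 / n := by
    have : 0 ≤ d * ε := by positivity
    nlinarith
  have hεn : ε ≤ 1 / n := by
    rw [hε, one_div]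
    exact inv_anti₀ hn0 (le_self_pow₀ hn1 (by norm_num))
  have hK1 : (1 : ℝ) ≤ (K : ℝ) ^ d := one_le_pow₀ (hH1.trans hHK)
  set β := b / a with hβ
  have hβ0 : 0 < β := div_pos hb ha
  have hbound : (64 * H ^ 2 + 64 * H * K) * (4 * β * ((K : ℝ) ^ d / n + d * ε) + 0) +
      2 * H ^ 2 * ε + 4 * H ^ 2 * 0 + 2 * 0 +
        2 * (H ^ 2 * (n * (d * ε)) + H ^ 2 * (n * (d * ε))) ≤
      (1024 * β + 6) * (H * (K : ℝ) ^ (d + 1)) / n := by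
    have hHH : H ^ 2 ≤ H * K := by nlinarith
    have hHH' : H ^ 2 ≤ H * (K : ℝ) ^ (d + 1) := by
      calc H ^ 2 ≤ H * K * 1 := by linarith
        _ ≤ H * K * (K : ℝ) ^ d := by gcongr
        _ = _ := by ring
    have e1 : (K : ℝ) ^ d / n + d * ε ≤ 2 * ((K : ℝ) ^ d / n) := by
      have : 1 / (n : ℝ) ≤ (K : ℝ) ^ d / n := by gcongr
      linarith
    calc _ ≤ (64 * (H * K) + 64 * H * K) * (4 * β * (2 * ((K : ℝ) ^ d / n)) + 0) +
          2 * (H * (K : ℝ) ^ (d + 1)) * (1 / n) + 4 * H ^ 2 * 0 + 2 * 0 +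
          2 * (H * (K : ℝ) ^ (d + 1) * (1 / n) + H * (K : ℝ) ^ (d + 1) * (1 / n)) := by
          gcongr
      _ = _ := by ring
  have hA1 : 1 ≤ 1024 * β + 6 := by linarith
  calc _ ≤ d * ((1024 * β + 6) * (H * (K : ℝ) ^ (d + 1)) / n) := by gcongr
    _ ≤ d * ((1024 * β + 6) * (H * (7 * H * L) ^ (d + 1)) / n) := by gcongr
    _ = d * (7 ^ (d + 1) * (1024 * β + 6)) * H ^ (d + 2) / n * L ^ (d + 1) := by ring
    _ ≤ d * (7 ^ (d + 2) * (1024 * β + 6) ^ (d + 2)) * H ^ (d + 2) / n * L ^ (d + 1) := by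
        gcongr
        · norm_num
        · norm_num
        · exact le_self_pow₀ hA1 (by omega)
    _ = _ := by rw [mul_pow, mul_pow]; ring

/-! ### Moments and tails under subexponential priors -/

theorem measure_le_of_mem_subEPriors {d : ℕ} {s : ℝ} {G : Prior d} (hG : G ∈ subEPriors d s)
    (j : Fin d) {t : ℝ} (ht : 0 < t) :
    (G : Measure (Fin d → ℝ≥0)) {θ | t ≤ (θ j : ℝ)} ≤ ENNReal.ofReal (2 * Real.exp (-t / s)) := by
  have h1 := hG j t.toNNReal (Real.toNNReal_pos.2 ht)
  rw [Measure.map_apply (by fun_prop) measurableSet_Ici, Real.coe_toNNReal _ ht.le] at h1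
  convert h1 using 3
  ext θ
  exact Real.toNNReal_le_iff_le_coe.symm

/-- The exponential moment of a subexponential prior, by comparison with a geometric series over
the cells `k s ≤ θ j < (k + 1) s`. -/
theorem lintegral_exp_le_of_mem_subEPriors {d : ℕ} {s : ℝ} (hs : 0 < s) {G : Prior d}
    (hG : G ∈ subEPriors d s) (j : Fin d) :
    ∫⁻ θ, ENNReal.ofReal (Real.exp ((θ j : ℝ) / (2 * s))) ∂(G : Measure (Fin d → ℝ≥0)) ≤
      ENNReal.ofReal 10 := by
  have htail : ∀ k : ℕ, (G : Measure (Fin d → ℝ≥0)) {θ | k * s ≤ (θ j : ℝ)} ≤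
      ENNReal.ofReal (2 * Real.exp (-(k : ℝ))) := by
    intro k
    rcases Nat.eq_zero_or_pos k with rfl | hk
    · refine prob_le_one.trans ?_
      simp
    · refine (measure_le_of_mem_subEPriors hG j (by positivity : 0 < (k : ℝ) * s)).trans_eq ?_
      congr 3
      field_simp
  have hmeas : ∀ k : ℕ, MeasurableSet {θ : Fin d → ℝ≥0 | k * s ≤ (θ j : ℝ)} := fun k =>
    measurableSet_le measurable_const (by fun_prop)
  set r : ℝ := Real.exp (-(1 / 2)) with hr
  have hr1 : r ≤ 2 / 3 := by
    have h1 := Real.add_one_le_exp (1 / 2 : ℝ)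
    rw [hr, Real.exp_neg, inv_le_comm₀ (Real.exp_pos _) (by norm_num)]
    linarith
  have hr0 : 0 ≤ r := (Real.exp_pos _).le
  have hsqrt : Real.exp (1 / 2) ≤ 5 / 3 := by
    have h1 : Real.exp (1 / 2) ^ 2 = Real.exp 1 := by
      rw [← Real.exp_nat_mul]; norm_num
    nlinarith [Real.exp_one_lt_d9, Real.exp_pos (1 / 2 : ℝ)]
  have hpt : ∀ θ : Fin d → ℝ≥0, ENNReal.ofReal (Real.exp ((θ j : ℝ) / (2 * s))) ≤
      ∑' k : ℕ, {θ : Fin d → ℝ≥0 | k * s ≤ (θ j : ℝ)}.indicator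
        (fun _ => ENNReal.ofReal (Real.exp (((k : ℝ) + 1) / 2))) θ := by
    intro θ
    have hθ : 0 ≤ (θ j : ℝ) / s := by positivity
    refine le_trans ?_ (ENNReal.le_tsum ⌊(θ j : ℝ) / s⌋₊)
    rw [Set.indicator_of_mem
      (by exact (le_div_iff₀ hs).1 (Nat.floor_le hθ))]
    refine ENNReal.ofReal_le_ofReal (Real.exp_le_exp.2 ?_)
    rw [show (θ j : ℝ) / (2 * s) = (θ j : ℝ) / s / 2 by field_simp]
    linarith [Nat.lt_floor_add_one ((θ j : ℝ) / s)]
  have hterm : ∀ k : ℕ, ∫⁻ θ, {θ : Fin d → ℝ≥0 | k * s ≤ (θ j : ℝ)}.indicator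
        (fun _ => ENNReal.ofReal (Real.exp (((k : ℝ) + 1) / 2))) θ ∂(G : Measure (Fin d → ℝ≥0)) ≤
      ENNReal.ofReal (10 / 3 * r ^ k) := by
    intro k
    rw [lintegral_indicator (hmeas k), lintegral_const, Measure.restrict_apply_univ]
    refine (mul_le_mul_right (htail k) _).trans ?_
    rw [← ENNReal.ofReal_mul (Real.exp_pos _).le]
    refine ENNReal.ofReal_le_ofReal ?_
    have e1 : Real.exp (((k : ℝ) + 1) / 2) * (2 * Real.exp (-(k : ℝ))) =
        2 * Real.exp (1 / 2) * r ^ k := by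
      rw [hr, ← Real.exp_nat_mul, mul_left_comm, ← Real.exp_add, mul_assoc, ← Real.exp_add]
      congr 2
      ring
    rw [e1]
    gcongr
    linarith
  refine (lintegral_mono hpt).trans ?_
  rw [lintegral_tsum fun k => (measurable_const.indicator (hmeas k)).aemeasurable]
  refine (ENNReal.tsum_le_tsum hterm).trans ?_
  have hsum : Summable fun k : ℕ => r ^ k := summable_geometric_of_lt_one hr0 (by linarith)
  rw [← ENNReal.ofReal_tsum_of_nonneg (fun k => by positivity) (hsum.mul_left _), tsum_mul_left,
    tsum_geometric_of_lt_one hr0 (by linarith)]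
  refine ENNReal.ofReal_le_ofReal ?_
  have : (1 - r)⁻¹ ≤ 3 := by
    rw [inv_le_comm₀ (by linarith) (by norm_num)]; linarith
  linarith

theorem subEPriors_mono {d : ℕ} {s t : ℝ} (hs : 0 < s) (hst : s ≤ t) :
    subEPriors d s ⊆ subEPriors d t := by
  intro G hG j u hu
  refine (hG j u hu).trans (ENNReal.ofReal_le_ofReal ?_)
  gcongr 2 * Real.exp ?_
  rw [neg_div, neg_div, neg_le_neg_iff]
  gcongr

theorem lintegral_pow_four_le_of_mem_subEPriors {d : ℕ} {s : ℝ} (hs : 0 < s) {G : Prior d}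
    (hG : G ∈ subEPriors d s) (j : Fin d) :
    ∫⁻ θ, ENNReal.ofReal ((θ j : ℝ) ^ 4) ∂(G : Measure (Fin d → ℝ≥0)) ≤
      ENNReal.ofReal (3840 * s ^ 4) := by
  calc _ ≤ ∫⁻ θ, ENNReal.ofReal (384 * s ^ 4) *
        ENNReal.ofReal (Real.exp ((θ j : ℝ) / (2 * s))) ∂(G : Measure (Fin d → ℝ≥0)) := by
        refine lintegral_mono fun θ => ?_
        rw [← ENNReal.ofReal_mul (by positivity)]
        refine ENNReal.ofReal_le_ofReal ?_
        have h1 := Real.pow_div_factorial_le_exp (x := (θ j : ℝ) / (2 * s)) (by positivity) 4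
        calc (θ j : ℝ) ^ 4 = 384 * s ^ 4 * (((θ j : ℝ) / (2 * s)) ^ 4 / (Nat.factorial 4)) := by
              rw [show Nat.factorial 4 = 24 from rfl]
              push_cast
              field_simp
              ring
          _ ≤ _ := by gcongr
    _ ≤ ENNReal.ofReal (384 * s ^ 4) * ENNReal.ofReal 10 := by
        rw [lintegral_const_mul' _ _ ENNReal.ofReal_ne_top]
        gcongr
        exact lintegral_exp_le_of_mem_subEPriors hs hG j
    _ = _ := by
        rw [← ENNReal.ofReal_mul (by positivity)]
        congr 1
        ring

/-- The base `1 + 1 / (2 s)` at which the generating function of the mixture becomes the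
exponential moment of order `1 / (2 s)` of the prior. -/
noncomputable def tiltBase (s : ℝ) : ℝ≥0 := 1 + (1 / (2 * s)).toNNReal

theorem coe_tiltBase {s : ℝ} (hs : 0 < s) : (tiltBase s : ℝ) = 1 + 1 / (2 * s) := by
  rw [tiltBase, NNReal.coe_add, Real.coe_toNNReal _ (by positivity)]
  simp

theorem inv_le_log_tiltBase {s : ℝ} (hs : 1 ≤ s) : 1 / (3 * s) ≤ Real.log (tiltBase s) := by
  have hs0 : 0 < s := by linarith
  have h1 := Real.one_sub_inv_le_log_of_pos (x := (tiltBase s : ℝ))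
    (by rw [coe_tiltBase hs0]; positivity)
  refine le_trans ?_ h1
  rw [coe_tiltBase hs0]
  have : 1 - (1 + 1 / (2 * s))⁻¹ = 1 / (2 * s + 1) := by
    field_simp; ring
  rw [this]
  gcongr
  linarith

theorem lintegral_exp_tiltBase_le {d : ℕ} {s : ℝ} (hs : 0 < s) {G : Prior d}
    (hG : G ∈ subEPriors d s) (j : Fin d) :
    ∫⁻ θ, ENNReal.ofReal (Real.exp ((θ j : ℝ) * (tiltBase s - 1)))
      ∂(G : Measure (Fin d → ℝ≥0)) ≤ ENNReal.ofReal 10 := by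
  refine le_trans (le_of_eq ?_) (lintegral_exp_le_of_mem_subEPriors hs hG j)
  refine lintegral_congr fun θ => ?_
  rw [coe_tiltBase hs]
  congr 2
  ring

theorem coordTail_le_exp_of_mem_subEPriors {d : ℕ} {s : ℝ} (hs : 1 ≤ s) {G : Prior d}
    (hG : G ∈ subEPriors d s) (j : Fin d) (K : ℕ) :
    coordTail (mixture G) K j ≤ ENNReal.ofReal (10 * Real.exp (-(K / (3 * s)))) := by
  have hs0 : 0 < s := by linarith
  have hz : 1 ≤ tiltBase s := le_self_add
  have hz0 : 0 < (tiltBase s : ℝ) := by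
    rw [coe_tiltBase hs0]; positivity
  have h1 := (pow_mul_coordTail_le (G : Measure (Fin d → ℝ≥0)) K j hz).trans
    (lintegral_exp_tiltBase_le hs0 hG j)
  have h2 : ENNReal.ofReal (Real.exp (K / (3 * s))) ≤ (tiltBase s : ℝ≥0∞) ^ K := by
    rw [← ENNReal.ofReal_coe_nnreal, ← ENNReal.ofReal_pow hz0.le]
    refine ENNReal.ofReal_le_ofReal ?_
    rw [← Real.exp_log hz0, ← Real.exp_nat_mul]
    refine Real.exp_le_exp.2 ?_
    rw [div_eq_mul_one_div]
    gcongr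
    exact inv_le_log_tiltBase hs
  have h3 : ENNReal.ofReal (Real.exp (K / (3 * s))) * coordTail (mixture G) K j ≤
      ENNReal.ofReal 10 := by
    refine le_trans ?_ h1
    gcongr
    exact le_rfl
  rw [Real.exp_neg, ← div_eq_mul_inv, ENNReal.ofReal_div_of_pos (Real.exp_pos _),
    ENNReal.le_div_iff_mul_le (Or.inl (ENNReal.ofReal_pos.2 (Real.exp_pos _)).ne')
      (Or.inl ENNReal.ofReal_ne_top), mul_comm]
  exact h3

theorem tsum_pow_four_mul_mixture_le {d : ℕ} {s : ℝ} (hs : 1 ≤ s) {G : Prior d}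
    (hG : G ∈ subEPriors d s) (j : Fin d) :
    ∑' y : Fin d → ℕ, ENNReal.ofReal ((y j : ℝ) ^ 4) * mixture G y ≤
      ENNReal.ofReal (19440 * s ^ 4) := by
  have hs0 : 0 < s := by linarith
  have hz0 : 0 < (tiltBase s : ℝ) := by
    rw [coe_tiltBase hs0]; positivity
  calc _ ≤ ∑' y : Fin d → ℕ, ENNReal.ofReal (1944 * s ^ 4) *
        ((tiltBase s : ℝ≥0∞) ^ y j * mixture G y) := by
        refine ENNReal.tsum_le_tsum fun y => ?_
        rw [← mul_assoc]
        gcongr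
        rw [← ENNReal.ofReal_coe_nnreal, ← ENNReal.ofReal_pow hz0.le,
          ← ENNReal.ofReal_mul (by positivity)]
        refine ENNReal.ofReal_le_ofReal ?_
        have h1 := Real.pow_div_factorial_le_exp (x := (y j : ℝ) / (3 * s)) (by positivity) 4
        have h2 : Real.exp ((y j : ℝ) / (3 * s)) ≤ (tiltBase s : ℝ) ^ y j := by
          rw [← Real.exp_log hz0, ← Real.exp_nat_mul]
          refine Real.exp_le_exp.2 ?_
          rw [div_eq_mul_one_div]
          gcongr
          exact inv_le_log_tiltBase hs
        calc (y j : ℝ) ^ 4 = 1944 * s ^ 4 * (((y j : ℝ) / (3 * s)) ^ 4 / (Nat.factorial 4)) := by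
              rw [show Nat.factorial 4 = 24 from rfl]
              push_cast
              field_simp
              ring
          _ ≤ _ := by
              gcongr
              exact h1.trans h2
    _ ≤ ENNReal.ofReal (1944 * s ^ 4) * ENNReal.ofReal 10 := by
        rw [ENNReal.tsum_mul_left]
        gcongr
        exact (tsum_pow_mul_mixLik _ j _).le.trans (lintegral_exp_tiltBase_le hs0 hG j)
    _ = _ := by
        rw [← ENNReal.ofReal_mul (by positivity)]
        congr 1
        ring

/-- A second moment over a rare event `A`, by the inequality `f² ≤ l f⁴ + 1 / l`. -/
theorem setLIntegral_sq_le {Ω : Type*} [MeasurableSpace Ω] (P : Measure Ω) {A : Set Ω}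
    {f : Ω → ℝ} {l M p : ℝ} (hl : 0 < l) (hM0 : 0 ≤ M) (hp0 : 0 ≤ p)
    (hM : ∫⁻ ω, ENNReal.ofReal (f ω ^ 4) ∂P ≤ ENNReal.ofReal M) (hp : P A ≤ ENNReal.ofReal p) :
    ∫⁻ ω in A, ENNReal.ofReal (f ω ^ 2) ∂P ≤ ENNReal.ofReal (l * M + p / l) := by
  calc _ ≤ ∫⁻ ω in A, (ENNReal.ofReal l * ENNReal.ofReal (f ω ^ 4) + ENNReal.ofReal l⁻¹) ∂P := by
        refine lintegral_mono fun ω => ?_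
        rw [← ENNReal.ofReal_mul hl.le, ← ENNReal.ofReal_add (by positivity) (by positivity)]
        refine ENNReal.ofReal_le_ofReal ?_
        have h1 : l * l⁻¹ = 1 := mul_inv_cancel₀ hl.ne'
        have h2 : 0 ≤ l⁻¹ * ((l * f ω ^ 2 - 1) ^ 2 + l * f ω ^ 2) := by positivity
        have h3 : l⁻¹ * ((l * f ω ^ 2 - 1) ^ 2 + l * f ω ^ 2) =
            l * f ω ^ 4 + l⁻¹ - f ω ^ 2 := by
          field_simp; ring
        linarith
    _ ≤ ENNReal.ofReal l * ENNReal.ofReal M + ENNReal.ofReal l⁻¹ * ENNReal.ofReal p := by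
        rw [lintegral_add_right _ measurable_const, lintegral_const,
          lintegral_const_mul' _ _ ENNReal.ofReal_ne_top, Measure.restrict_apply_univ]
        gcongr
        exact (setLIntegral_le_lintegral _ _).trans hM
    _ = _ := by
        rw [← ENNReal.ofReal_mul hl.le, ← ENNReal.ofReal_mul (by positivity),
          ← ENNReal.ofReal_add (by positivity) (by positivity)]
        congr 1
        ring

/-- The fourth power of the maximum is at most the sum of the fourth powers. -/
theorem lintegral_sampleMax_pow_four_le {d n : ℕ} [NeZero n] {s : ℝ} (hs : 1 ≤ s) {G : Prior d}
    (hG : G ∈ subEPriors d s) (j : Fin d) :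
    ∫⁻ Y, ENNReal.ofReal ((sampleMax Y j : ℝ) ^ 4)
      ∂(Measure.pi fun _ : Fin n => (mixture G).toMeasure) ≤
      ENNReal.ofReal (n * (19440 * s ^ 4)) := by
  calc _ ≤ ∫⁻ Y, ∑ i : Fin n, ENNReal.ofReal ((Y i j : ℝ) ^ 4)
        ∂(Measure.pi fun _ : Fin n => (mixture G).toMeasure) := by
        refine lintegral_mono fun Y => ?_
        obtain ⟨i, -, hi⟩ := Finset.exists_mem_eq_sup (Finset.univ : Finset (Fin n))
          Finset.univ_nonempty (fun i => Y i j)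
        rw [sampleMax, hi]
        exact Finset.single_le_sum (f := fun i => ENNReal.ofReal ((Y i j : ℝ) ^ 4))
          (fun _ _ => zero_le) (Finset.mem_univ i)
    _ ≤ ∑ _i : Fin n, ENNReal.ofReal (19440 * s ^ 4) := by
        rw [lintegral_finsetSum _ fun i _ => measurable_of_countable _]
        refine Finset.sum_le_sum fun i _ => ?_
        rw [lintegral_pi_eval_eq_tsum (mixture G) (fun y => ENNReal.ofReal ((y j : ℝ) ^ 4)) i]
        exact tsum_pow_four_mul_mixture_le hs hG j
    _ = _ := by
        rw [ENNReal.ofReal_mul (Nat.cast_nonneg n), ENNReal.ofReal_natCast]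
        simp

/-! ### Subexponential priors -/

/-- Both the truncation level `h` of the prior and the level `K` of the sample are about
`27 s log n`, so that `h K * K ^ d / n` is of the claimed order; the terms from outside the box are at
most a multiple of `s² / n`. -/
theorem regret_le_of_subexponential {a b : ℝ} (ha : 0 < a) (hb : 0 < b) {d n : ℕ} [NeZero n]
    (hd : d ≤ n) {dist : PMF (Fin d → ℕ) → PMF (Fin d → ℕ) → ℝ≥0∞} (hdec : IsDecomposable dist)
    (hsand : IsSandwiched a b dist) {Ghat : (Fin n → Fin d → ℕ) → Prior d} {s : ℝ} (hs : 0 < s)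
    (hn : 2 ≤ n) (hmin : ∀ Y, IsMinDist dist Set.univ (empirical Y) (Ghat Y))
    {G : Prior d} (hG : G ∈ subEPriors d s) :
    regret Ghat G ≤ ENNReal.ofReal
      ((d : ℝ) * (29 * (1024 * (b / a) + 46700) * max 1 s) ^ (d + 2) / (n : ℝ) *
        (Real.log n) ^ (d + 2)) := by
  set S := max 1 s with hS
  have hS1 : 1 ≤ S := le_max_left _ _
  have hS0 : 0 < S := by linarith
  have hGS : G ∈ subEPriors d S := subEPriors_mono hs (le_max_right _ _) hG
  have hn2 : (2 : ℝ) ≤ n := by exact_mod_cast hn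
  have hn0 : (0 : ℝ) < n := by linarith
  have hn1 : (1 : ℝ) ≤ n := by linarith
  have hdn : (d : ℝ) ≤ n := by exact_mod_cast hd
  set x := Real.log n with hx
  have hx2 : 0.69 ≤ x := by
    have := Real.log_le_log (by norm_num) hn2
    linarith [Real.log_two_gt_d9]
  have hx0 : 0 < x := by linarith
  have hSx : 0.69 ≤ S * x := by nlinarith
  set K := ⌈27 * S * x⌉₊ with hK
  have hKge : 27 * S * x ≤ K := Nat.le_ceil _
  have hKle : (K : ℝ) ≤ 29 * S * x := by
    have := Nat.ceil_lt_add_one (by positivity : 0 ≤ 27 * S * x)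
    linarith
  have hSK : S ≤ K := by nlinarith
  have hK1 : (1 : ℝ) ≤ K := hS1.trans hSK
  set ε : ℝ := ((n : ℝ) ^ 5)⁻¹ with hε
  have hε0 : 0 ≤ ε := by positivity
  have hexp : ∀ m : ℕ, Real.exp (-(m * x)) = ((n : ℝ) ^ m)⁻¹ := by
    intro m
    rw [Real.exp_neg, Real.exp_nat_mul, hx, Real.exp_log hn0]
  -- The exponent `9` leaves a factor `n⁴ ≥ 16` to absorb the numerical constants.
  have hε16 : 10 * Real.exp (-(9 * x)) ≤ ε := by
    have h1 := hexp 9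
    push_cast at h1
    have h2 : (2 : ℝ) ^ 4 ≤ (n : ℝ) ^ 4 := by gcongr
    rw [h1, hε, show (n : ℝ) ^ 9 = n ^ 4 * n ^ 5 by ring, mul_inv, ← mul_assoc]
    refine mul_le_of_le_one_left (by positivity) ?_
    rw [← div_eq_mul_inv, div_le_one (by positivity)]
    linarith
  have hT : ∀ j, coordTail (mixture G) K j ≤ ENNReal.ofReal ε := by
    intro j
    refine (coordTail_le_exp_of_mem_subEPriors hS1 hGS j K).trans
      (ENNReal.ofReal_le_ofReal (le_trans ?_ hε16))
    gcongr
    rw [le_div_iff₀ (by positivity)]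
    linarith
  have hδ : (G : Measure (Fin d → ℝ≥0)) {θ | ∀ j, (θ j : ℝ) ≤ K}ᶜ ≤ ENNReal.ofReal (d * ε) := by
    have hsub : {θ : Fin d → ℝ≥0 | ∀ j, (θ j : ℝ) ≤ K}ᶜ ⊆ ⋃ j, {θ | (K : ℝ) ≤ (θ j : ℝ)} := by
      intro θ hθ
      simp only [Set.mem_compl_iff, Set.mem_ofPred_eq, not_forall, not_le] at hθ
      obtain ⟨j, hj⟩ := hθ
      exact Set.mem_iUnion.2 ⟨j, hj.le⟩
    refine (measure_mono hsub).trans ((measure_iUnion_le _).trans ?_)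
    rw [tsum_fintype, ENNReal.ofReal_mul (Nat.cast_nonneg d), ENNReal.ofReal_natCast]
    have h1 : ∀ j : Fin d, (G : Measure (Fin d → ℝ≥0)) {θ | (K : ℝ) ≤ (θ j : ℝ)} ≤
        ENNReal.ofReal ε := by
      intro j
      refine (measure_le_of_mem_subEPriors hGS j (by linarith : (0 : ℝ) < K)).trans
        (ENNReal.ofReal_le_ofReal (le_trans ?_ hε16))
      gcongr
      · norm_num
      · rw [neg_div, neg_le_neg_iff, le_div_iff₀ hS0]
        nlinarith
    refine (Finset.sum_le_sum fun j _ => h1 j).trans_eq ?_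
    simp
  have hp : (Measure.pi fun _ : Fin n => (mixture G).toMeasure)
      {Y : Fin n → Fin d → ℕ | ∀ i j, Y i j < K}ᶜ ≤ ENNReal.ofReal (n * (d * ε)) := by
    refine (measure_compl_forall_lt_le (mixture G) K).trans ?_
    rw [ENNReal.ofReal_mul (by positivity), ENNReal.ofReal_natCast]
    gcongr
    refine (Finset.sum_le_sum fun k _ => hT k).trans_eq ?_
    rw [ENNReal.ofReal_mul (by positivity)]
    simp
  have hsupp : ∀ Y, ∀ᵐ θ ∂(Ghat Y : Measure (Fin d → ℝ≥0)), ∀ j, (θ j : ℝ) ≤ sampleMax Y j :=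
    fun Y => ae_le_sampleMax_of_isMinDist hdec hsand (hmin Y)
  have hbox : ∀ Y : Fin n → Fin d → ℕ, (∀ i j, Y i j < K) →
      ∀ᵐ θ ∂(Ghat Y : Measure (Fin d → ℝ≥0)), ∀ j, (θ j : ℝ) ≤ K := by
    intro Y hY
    refine (hsupp Y).mono fun θ hθ j => (hθ j).trans ?_
    exact_mod_cast Finset.sup_le fun i _ => (hY i j).le
  -- The weights `l = 1 / (S² n)` and `l = 1 / (S² n²)` in `setLIntegral_sq_le` make both the fourth
  -- moments and the rare-event probabilities contribute a multiple of `S² / n`.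
  set τ : ℝ := 1 / (S ^ 2 * n) * (3840 * S ^ 4) + d * ε / (1 / (S ^ 2 * n)) with hτ
  set w : ℝ := 1 / (S ^ 2 * n ^ 2) * (n * (19440 * S ^ 4)) +
    n * (d * ε) / (1 / (S ^ 2 * n ^ 2)) with hw
  have hmain := regret_le_ofReal (V := fun Y j => sampleMax Y j) (K := K) (h := K) (δ := d * ε)
    (τ := τ) (w := w) ha hb hsand (fun Y => (hmin Y).2 G trivial) (by positivity) hbox
    (fun _ _ => by positivity) hsupp hε0 (by positivity) (by positivity) (by positivity) hT hδ
    (fun j => by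
      have h1 := setLIntegral_sq_le (G : Measure (Fin d → ℝ≥0)) (f := fun θ => (θ j : ℝ))
        (l := 1 / (S ^ 2 * n)) (by positivity) (by positivity) (by positivity)
        (lintegral_pow_four_le_of_mem_subEPriors hS0 hGS j) hδ
      refine le_trans (le_of_eq ?_) h1
      refine lintegral_congr fun θ => ?_
      rw [ENNReal.ofReal_pow (by positivity), ENNReal.ofReal_coe_nnreal])
    (fun j => setLIntegral_sq_le _ (by positivity) (by positivity) (by positivity)
      (lintegral_sampleMax_pow_four_le hS1 hGS j) hp)
  refine hmain.trans (ENNReal.ofReal_le_ofReal ?_)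
  have hn4 : n ^ 3 * (n * (d * ε)) ≤ 1 := by
    calc (n : ℝ) ^ 3 * (n * (d * ε)) ≤ n ^ 3 * (n * (n * ε)) := by gcongr
      _ = 1 := by rw [hε]; field_simp
  have hnde0 : 0 ≤ n * (d * ε) := by positivity
  have hde0 : 0 ≤ d * ε := by positivity
  have hnde2 : n ^ 2 * (n * (d * ε)) ≤ 1 / n := by
    rw [le_div_iff₀ hn0]
    linarith
  have hnde : n * (d * ε) ≤ 1 / n :=
    le_trans (le_mul_of_one_le_left hnde0 (one_le_pow₀ hn1)) hnde2
  have hde : d * ε ≤ 1 / n := le_trans (le_mul_of_one_le_left hde0 hn1) hnde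
  have hεn : ε ≤ 1 / n := by
    rw [hε, one_div]
    exact inv_anti₀ hn0 (le_self_pow₀ hn1 (by norm_num))
  have hτle : τ ≤ 3841 * (S ^ 2 * (1 / n)) := by
    have e1 : τ = 3840 * (S ^ 2 * (1 / n)) + S ^ 2 * (n * (d * ε)) := by
      rw [hτ]; field_simp
    have e2 : S ^ 2 * (n * (d * ε)) ≤ S ^ 2 * (1 / n) := by gcongr
    linarith
  have hwle : w ≤ 19441 * (S ^ 2 * (1 / n)) := by
    have e1 : w = 19440 * (S ^ 2 * (1 / n)) + S ^ 2 * (n ^ 2 * (n * (d * ε))) := by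
      rw [hw]; field_simp
    have e2 : S ^ 2 * (n ^ 2 * (n * (d * ε))) ≤ S ^ 2 * (1 / n) := by gcongr
    linarith
  have hKd : (1 : ℝ) ≤ (K : ℝ) ^ d := one_le_pow₀ hK1
  have hK2 : (K : ℝ) ^ 2 ≤ (K : ℝ) ^ (d + 2) := pow_le_pow_right₀ hK1 (by omega)
  have hS2 : S ^ 2 ≤ (K : ℝ) ^ (d + 2) := le_trans (by gcongr) hK2
  set β := b / a with hβ
  have hβ0 : 0 < β := div_pos hb ha
  have hbound : (64 * (K : ℝ) ^ 2 + 64 * K * K) * (4 * β * ((K : ℝ) ^ d / n + d * ε) + d * ε) +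
      2 * (K : ℝ) ^ 2 * ε + 4 * (K : ℝ) ^ 2 * (d * ε) + 2 * τ +
        2 * (w + (K : ℝ) ^ 2 * (n * (d * ε))) ≤
      (1024 * β + 46700) * (K : ℝ) ^ (d + 2) / n := by
    have e1 : (K : ℝ) ^ d / n + d * ε ≤ 2 * ((K : ℝ) ^ d / n) := by
      have : 1 / (n : ℝ) ≤ (K : ℝ) ^ d / n := by gcongr
      linarith
    have e2 : d * ε ≤ (K : ℝ) ^ d / n := hde.trans (by gcongr)
    calc _ ≤ (64 * (K : ℝ) ^ 2 + 64 * K * K) *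
          (4 * β * (2 * ((K : ℝ) ^ d / n)) + (K : ℝ) ^ d / n) +
          2 * (K : ℝ) ^ (d + 2) * (1 / n) + 4 * (K : ℝ) ^ (d + 2) * (1 / n) +
          2 * (3841 * ((K : ℝ) ^ (d + 2) * (1 / n))) +
          2 * (19441 * ((K : ℝ) ^ (d + 2) * (1 / n)) + (K : ℝ) ^ (d + 2) * (1 / n)) := by
          gcongr
          · refine hτle.trans ?_
            gcongr
          · refine hwle.trans ?_
            gcongr
      _ = (1024 * β + 46700) * (K : ℝ) ^ (d + 2) / n := by ring
  have hA1 : 1 ≤ 1024 * β + 46700 := by linarith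
  calc _ ≤ d * ((1024 * β + 46700) * (K : ℝ) ^ (d + 2) / n) := by gcongr
    _ ≤ d * ((1024 * β + 46700) ^ (d + 2) * (29 * S * x) ^ (d + 2) / n) := by
        gcongr
        exact le_self_pow₀ hA1 (by omega)
    _ = _ := by rw [mul_pow, mul_pow, mul_pow, mul_pow]; ring

theorem mainTheorem6 (a b : ℝ) (ha : 0 < a) (hb : 0 < b) :
    ∃ c₁ c₂ : ℝ, 0 < c₁ ∧ 0 < c₂ ∧
      ∀ (d n : ℕ) [NeZero n], d ≤ n →
        ∀ dist : PMF (Fin d → ℕ) → PMF (Fin d → ℕ) → ℝ≥0∞,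
          IsDecomposable dist → IsSandwiched a b dist →
          ∀ Ghat : (Fin n → Fin d → ℕ) → Prior d,
            (∀ h : ℝ, 0 ≤ h → 3 ≤ n →
              (∀ Y, IsMinDist dist (boxPriors d h) (empirical Y) (Ghat Y)) →
              ∀ G ∈ boxPriors d h,
                regret Ghat G ≤ ENNReal.ofReal
                  ((d : ℝ) * (c₁ * max 1 h) ^ (d + 2) / (n : ℝ) *
                    (Real.log n / Real.log (Real.log n)) ^ (d + 1))) ∧
            (∀ s : ℝ, 0 < s → 2 ≤ n →
              (∀ Y, IsMinDist dist Set.univ (empirical Y) (Ghat Y)) →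
              ∀ G ∈ subEPriors d s,
                regret Ghat G ≤ ENNReal.ofReal
                  ((d : ℝ) * (c₂ * max 1 s) ^ (d + 2) / (n : ℝ) *
                    (Real.log n) ^ (d + 2))) := by
  have hba : 0 < b / a := div_pos hb ha
  refine ⟨7 * (1024 * (b / a) + 6), 29 * (1024 * (b / a) + 46700), by positivity, by positivity,
    fun d n _ hd dist hdec hsand Ghat => ⟨fun h _ hn hmin G hG => ?_,
      fun s hs hn hmin G hG => ?_⟩⟩
  · exact regret_le_of_box ha hb hd hsand hn hmin hG
  · exact regret_le_of_subexponential ha hb hd hdec hsand hs hn hmin hG
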